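/- For $p\in\mathbb N=\{0,1,2,\dots\}$ let $C_p=\mathrm{Cl}(\mathbb R^p)$ be the real Clifford algebra generated by $u_1,\dots,u_p$ with $u_i^2=-1$ and $u_iu_j=-u_ju_i$ for $i\neq j$, and let $C_p\otimes C_q$ be the ordinary tensor product over $\mathbb R$ (the two factors commute), bigraded by $\mathbb Z/2\times\mathbb Z/2$ so that $(C_p\otimes C_q)^{ij}=C_p^i\otimes C_q^j$; thus the generators of $C_p$ have bidegree $(1,0)$ and those of $C_q$ have bidegree $(0,1)$. A bigraded $C_p\otimes C_q$-module is a $C_p\otimes C_q$-module $S=S^{00}\oplus S^{10}\oplus S^{01}\oplus S^{11}$ with $(C_p\otimes C_q)^{d}S^{e}\subseteq S^{d+e}$. It is indecomposable if it is nonzero and not the direct sum of two nonzero bigraded submodules. Isomorphisms of bigraded modules are the $C_p\otimes C_q$-linear bijections that preserve the bidegree. Proposition. Let $p,q\in\mathbb N$. (1) The number of isomorphism classes of indecomposable bigraded $C_p\otimes C_q$-modules equals $$\begin{cases}4&\text{if } p\equiv q\equiv 0 \pmod 4,\\ 2&\text{if exactly one of } p,q \text{ is} \equiv 0 \pmod 4,\text{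 or } p\equiv q\equiv 2 \pmod 4,\\ 1&\text{otherwise.}\end{cases}$$ (2) The number of isomorphism classes of indecomposable ungraded $C_p\otimes C_q$-modules equals $$\begin{cases}4&\text{if } p\equiv q\equiv 3 \pmod 4,\\ 2&\text{if exactly one of } p,q \text{ is} \equiv 3 \pmod 4,\text{ or } p\equiv q\equiv 1 \pmod 4,\\ 1&\text{otherwise.}\end{cases}$$ -/

import Mathlib

open scoped TensorProduct

universe u

noncomputable section

/-- The quadratic form `v ↦ -|v|²` on `ℝᵖ`. -/
abbrev negSumSquares (p : ℕ) : QuadraticForm ℝ (Fin p → ℝ) :=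
  QuadraticMap.weightedSumSquares ℝ (fun _ : Fin p => (-1 : ℝ))

/-- The real Clifford algebra `C_p = Cl(ℝᵖ)` of the Euclidean space `ℝᵖ`, with the sign convention
`v * v = -|v|²`, so that an orthonormal basis satisfies `u_i² = -1` and `u_i u_j = -u_j u_i`. -/
abbrev Cl (p : ℕ) : Type := CliffordAlgebra (negSumSquares p)

/-- The (ordinary, not super) tensor product `C_p ⊗ C_q`: the two factors commute. -/
abbrev ClTensor (p q : ℕ) : Type := Cl p ⊗[ℝ] Cl q

/-- The bidegree `(i, j)` part `C_pⁱ ⊗ C_qʲ` of `C_p ⊗ C_q`, for the bigrading by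
`ℤ/2 × ℤ/2` in which the generators `u_i` have bidegree `(1, 0)` and the `w_j` bidegree `(0, 1)`. -/
def ClTensor.bidegree (p q : ℕ) (d : ZMod 2 × ZMod 2) : Submodule ℝ (ClTensor p q) :=
  Submodule.map₂ (TensorProduct.mk ℝ (Cl p) (Cl q))
    (CliffordAlgebra.evenOdd (negSumSquares p) d.1)
    (CliffordAlgebra.evenOdd (negSumSquares q) d.2)

/-- A `ℤ/2`-bigraded `C_p ⊗ C_q`-module `S = S⁰⁰ ⊕ S¹⁰ ⊕ S⁰¹ ⊕ S¹¹`: a (left) module with a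
decomposition into real subspaces such that `(C_p ⊗ C_q)ᵈ Sᵉ ⊆ Sᵈ⁺ᵉ`. -/
structure BigradedModule (p q : ℕ) : Type (u + 1) where
  carrier : Type u
  [addCommGroup : AddCommGroup carrier]
  [realModule : Module ℝ carrier]
  [module : Module (ClTensor p q) carrier]
  [isScalarTower : IsScalarTower ℝ (ClTensor p q) carrier]
  component : ZMod 2 × ZMod 2 → Submodule ℝ carrier
  isInternal : DirectSum.IsInternal component
  smul_mem : ∀ (d e : ZMod 2 × ZMod 2), ∀ a ∈ ClTensor.bidegree p q d, ∀ s ∈ component e,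
    a • s ∈ component (d + e)

namespace BigradedModule

attribute [instance] addCommGroup realModule module isScalarTower

variable {p q : ℕ}

/-- A `C_p ⊗ C_q`-submodule `N` of a bigraded module `S` is a bigraded submodule if
`N = ⨁ N ∩ Sᵈ`, that is, if it is spanned by its homogeneous elements. -/
def IsBigradedSubmodule (S : BigradedModule.{u} p q) (N : Submodule (ClTensor p q) S.carrier) :
    Prop :=
  N.restrictScalars ℝ = ⨆ d, N.restrictScalars ℝ ⊓ S.component d

/-- A bigraded module is indecomposable if it is nonzero and is not the direct sum of two nonzero
bigraded submodules. -/
def IsIndecomposable (S : BigradedModule.{u} p q) : Prop :=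
  Nontrivial S.carrier ∧
    ∀ N₁ N₂ : Submodule (ClTensor p q) S.carrier,
      S.IsBigradedSubmodule N₁ → S.IsBigradedSubmodule N₂ → IsCompl N₁ N₂ → N₁ = ⊥ ∨ N₂ = ⊥

/-- Isomorphism of bigraded modules: a `C_p ⊗ C_q`-linear bijection preserving the bidegree. -/
def Isomorphic (S T : BigradedModule.{u} p q) : Prop :=
  ∃ f : S.carrier ≃ₗ[ClTensor p q] T.carrier,
    ∀ d, ∀ s : S.carrier, s ∈ S.component d ↔ f s ∈ T.component d

theorem Isomorphic.equivalence (p q : ℕ) :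
    Equivalence (Isomorphic : BigradedModule.{u} p q → BigradedModule.{u} p q → Prop) where
  refl S := ⟨LinearEquiv.refl _ _, fun _ _ => Iff.rfl⟩
  symm := by
    rintro S T ⟨f, hf⟩
    exact ⟨f.symm, fun d s => by rw [hf d (f.symm s), f.apply_symm_apply]⟩
  trans := by
    rintro S T U ⟨f, hf⟩ ⟨g, hg⟩
    exact ⟨f.trans g, fun d s => (hf d s).trans (hg d (f s))⟩

/-- Isomorphism as an equivalence relation on the indecomposable bigraded modules. -/
def indecomposableSetoid (p q : ℕ) :
    Setoid {S : BigradedModule.{u} p q // S.IsIndecomposable} :=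
  Setoid.comap Subtype.val ⟨Isomorphic, Isomorphic.equivalence p q⟩

end BigradedModule

/-- The isomorphism classes of indecomposable bigraded `C_p ⊗ C_q`-modules. -/
abbrev IndecomposableBigradedClasses (p q : ℕ) : Type (u + 1) :=
  Quotient (BigradedModule.indecomposableSetoid.{u} p q)

/-- The isomorphism classes of indecomposable ungraded `C_p ⊗ C_q`-modules. -/
abbrev IndecomposableUngradedClasses (p q : ℕ) : Type (u + 1) :=
  Quotient (Setoid.comap
    (Subtype.val : {M : ModuleCat.{u} (ClTensor p q) // CategoryTheory.Indecomposable M} → _)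
    (CategoryTheory.isIsomorphicSetoid (ModuleCat.{u} (ClTensor p q))))

end

/-! ### Signed systems and averaging -/

/-- A family of operators with squares `σ i = ±1` that commute pairwise up to the signs `c i j`. -/
structure IsSignedSystem {ι V : Type*} [AddCommGroup V] [Module ℝ V] (σ : ι → ℤˣ)
    (c : ι → ι → ℤˣ) (a : ι → Module.End ℝ V) : Prop where
  sq : ∀ i, a i * a i = σ i • 1
  comm : ∀ i j, a i * a j = c i j • (a j * a i)

/-- The product of the operators indexed by a list. -/
def wordProd {ι V : Type*} [AddCommGroup V] [Module ℝ V] (a : ι → Module.End ℝ V)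
    (l : List ι) : Module.End ℝ V :=
  (l.map a).prod

/-- The sign with which the operator at `i` commutes with the product over `l`. -/
def commSign {ι : Type*} (c : ι → ι → ℤˣ) (i : ι) (l : List ι) : ℤˣ := (l.map (c i)).prod

/-- The sign of the square of the product over a list. -/
def sqSign {ι : Type*} (σ : ι → ℤˣ) (c : ι → ι → ℤˣ) : List ι → ℤˣ
  | [] => 1
  | i :: l => commSign c i l * σ i * sqSign σ c l

/-- The sum of the conjugates of `f` by the products over all sublists of a list. -/
def conjSum {ι V W : Type*} [AddCommGroup V] [Module ℝ V] [AddCommGroup W] [Module ℝ W]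
    (σ : ι → ℤˣ) (a : ι → Module.End ℝ V) (b : ι → Module.End ℝ W) :
    List ι → (V →ₗ[ℝ] W) → (V →ₗ[ℝ] W)
  | [], f => f
  | i :: l, f => conjSum σ a b l f + σ i • (b i ∘ₗ conjSum σ a b l f ∘ₗ a i)

/-- The span of the images of `s` under the products over all sublists of a list. -/
def orbitSpan {ι V : Type*} [AddCommGroup V] [Module ℝ V] (a : ι → Module.End ℝ V) (s : V) :
    List ι → Submodule ℝ V
  | [] => ℝ ∙ s
  | i :: l => orbitSpan a s l ⊔ (orbitSpan a s l).map (a i)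

theorem units_smul_mem {V : Type*} [AddCommGroup V] [Module ℝ V] (N : Submodule ℝ V) (e : ℤˣ)
    {x : V} (hx : x ∈ N) : e • x ∈ N := by
  rcases Int.units_eq_one_or e with rfl | rfl
  · simpa using hx
  · simpa [Units.smul_def] using hx

theorem units_smul_linearMap_apply {V W : Type*} [AddCommGroup V] [Module ℝ V] [AddCommGroup W]
    [Module ℝ W] (e : ℤˣ) (f : V →ₗ[ℝ] W) (x : V) : (e • f) x = e • f x := by
  rcases Int.units_eq_one_or e with rfl | rfl <;> simp [Units.smul_def]

theorem linearMap_units_smul {V W : Type*} [AddCommGroup V] [Module ℝ V] [AddCommGroup W]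
    [Module ℝ W] (e : ℤˣ) (f : V →ₗ[ℝ] W) (x : V) : f (e • x) = e • f x := by
  rcases Int.units_eq_one_or e with rfl | rfl <;> simp [Units.smul_def]

namespace IsSignedSystem

variable {ι V W : Type*} [AddCommGroup V] [Module ℝ V] [AddCommGroup W] [Module ℝ W]
  {σ : ι → ℤˣ} {c : ι → ι → ℤˣ} {a : ι → Module.End ℝ V} {b : ι → Module.End ℝ W}

theorem sq_apply (ha : IsSignedSystem σ c a) (i : ι) (x : V) : a i (a i x) = σ i • x := by
  have := LinearMap.congr_fun (ha.sq i) x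
  rwa [Module.End.mul_apply, units_smul_linearMap_apply, Module.End.one_apply] at this

theorem comm_apply (ha : IsSignedSystem σ c a) (i j : ι) (x : V) :
    a i (a j x) = c i j • a j (a i x) := by
  have := LinearMap.congr_fun (ha.comm i j) x
  rwa [Module.End.mul_apply, units_smul_linearMap_apply, Module.End.mul_apply] at this

theorem smul_smul_self {X : Type*} [AddCommGroup X] (e : ℤˣ) (x : X) : e • e • x = x := by
  rw [smul_smul, Int.units_mul_self, one_smul]

/-- In F + σ i • b i F a i, applying `b i` on the left or `a i` on the right exchanges the two
summands, because both operators have square σ i. Intertwining with an earlier `j` survives the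
step: the sign `c j i` arises once from `b` and once from `a`, and cancels. -/
theorem conjSum_comm (ha : IsSignedSystem σ c a) (hb : IsSignedSystem σ c b) (f : V →ₗ[ℝ] W)
    (l : List ι) : ∀ j ∈ l, ∀ x, b j (conjSum σ a b l f x) = conjSum σ a b l f (a j x) := by
  induction l with
  | nil => simp
  | cons i l ih =>
    intro j hj x
    simp only [conjSum, LinearMap.add_apply, units_smul_linearMap_apply, LinearMap.comp_apply,
      map_add, linearMap_units_smul]
    rcases List.mem_cons.mp hj with rfl | hj
    · rw [hb.sq_apply, ha.sq_apply, smul_smul_self, linearMap_units_smul, linearMap_units_smul,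
        smul_smul_self, add_comm]
    · have key : b j (b i (conjSum σ a b l f (a i x))) = b i (conjSum σ a b l f (a i (a j x))) := by
        rw [hb.comm_apply j i, ih j hj, ha.comm_apply j i, linearMap_units_smul,
          linearMap_units_smul, smul_smul_self]
      rw [ih j hj, key]

theorem conjSum_mem (N : Submodule ℝ W) (hN : ∀ i, ∀ x ∈ N, b i x ∈ N) (f : V →ₗ[ℝ] W)
    (hf : ∀ x, f x ∈ N) (l : List ι) : ∀ x, conjSum σ a b l f x ∈ N := by
  induction l with
  | nil => exact hf
  | cons i l ih =>
    intro x
    simp only [conjSum, LinearMap.add_apply, units_smul_linearMap_apply, LinearMap.comp_apply]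
    exact N.add_mem (ih x) (units_smul_mem _ _ (hN i _ (ih _)))

/-- On N each averaging step adds σ i • a i a i = 1 to the previous multiple of the identity, hence
doubles it. Dividing by this power of 2 turns the average of a projection back into a projection. -/
theorem conjSum_apply_of_mem (ha : IsSignedSystem σ c a) (N : Submodule ℝ V)
    (hN : ∀ i, ∀ x ∈ N, a i x ∈ N) (f : V →ₗ[ℝ] V) (hf : ∀ x ∈ N, f x = x) (l : List ι) :
    ∀ x ∈ N, conjSum σ a a l f x = (2 : ℝ) ^ l.length • x := by
  induction l with
  | nil => intro x hx; simp [conjSum, hf x hx]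
  | cons i l ih =>
    intro x hx
    simp only [conjSum, LinearMap.add_apply, units_smul_linearMap_apply, LinearMap.comp_apply]
    rw [ih x hx, ih _ (hN i x hx), map_smul, ha.sq_apply, smul_comm, smul_smul_self,
      ← two_smul ℝ, smul_smul, List.length_cons, pow_succ']

/-- An invariant subspace has an invariant complement. -/
theorem exists_isCompl [Finite ι] (ha : IsSignedSystem σ c a) (N : Submodule ℝ V)
    (hN : ∀ i, ∀ x ∈ N, a i x ∈ N) :
    ∃ N' : Submodule ℝ V, (∀ i, ∀ x ∈ N', a i x ∈ N') ∧ IsCompl N N' := by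
  have := Fintype.ofFinite ι
  set l : List ι := Finset.univ.toList
  have hl : ∀ i, i ∈ l := fun i => by simp [l]
  obtain ⟨P, hP⟩ := N.exists_isCompl
  -- Maschke's argument: average an arbitrary linear projection onto N; the kernel of the result is
  -- an invariant complement.
  let π : V →ₗ[ℝ] V := N.subtype ∘ₗ N.projectionOnto P hP
  have hπ : ∀ x ∈ N, π x = x := fun x hx => by
    simp [π, Submodule.projectionOnto_apply_left hP ⟨x, hx⟩]
  have hπ' : ∀ x, π x ∈ N := fun x => by simp [π]
  set g := conjSum σ a a l π
  have h2 : (2 : ℝ) ^ l.length ≠ 0 := by positivity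
  have hproj : LinearMap.IsProj N (((2 : ℝ) ^ l.length)⁻¹ • g) :=
    ⟨fun x => N.smul_mem _ (conjSum_mem N hN π hπ' l x), fun x hx => by
      rw [LinearMap.smul_apply, ha.conjSum_apply_of_mem N hN π hπ l x hx, smul_smul,
        inv_mul_cancel₀ h2, one_smul]⟩
  refine ⟨_, fun i x hx => ?_, hproj.isCompl⟩
  rw [LinearMap.mem_ker, LinearMap.smul_apply, smul_eq_zero_iff_right (inv_ne_zero h2)] at hx ⊢
  rw [← ha.conjSum_comm ha π l i (hl i), hx, map_zero]

theorem mem_orbitSpan (s : V) (l : List ι) : s ∈ orbitSpan a s l := by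
  induction l with
  | nil => exact Submodule.mem_span_singleton_self s
  | cons i l ih => exact Submodule.mem_sup_left ih

theorem finiteDimensional_orbitSpan (s : V) (l : List ι) :
    FiniteDimensional ℝ (orbitSpan a s l) := by
  induction l with
  | nil => rw [orbitSpan]; infer_instance
  | cons i l ih => rw [orbitSpan]; infer_instance

theorem orbitSpan_invariant (ha : IsSignedSystem σ c a) (s : V) (l : List ι) :
    ∀ j ∈ l, ∀ x ∈ orbitSpan a s l, a j x ∈ orbitSpan a s l := by
  induction l with
  | nil => simp
  | cons i l ih =>
    intro j hj x hx
    obtain ⟨y, hy, z, hz, rfl⟩ := Submodule.mem_sup.mp hx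
    obtain ⟨w, hw, rfl⟩ := Submodule.mem_map.mp hz
    rw [map_add, orbitSpan]
    rcases List.mem_cons.mp hj with rfl | hj
    · rw [ha.sq_apply, add_comm]
      exact Submodule.add_mem_sup (units_smul_mem _ _ hw) (Submodule.mem_map_of_mem hy)
    · rw [ha.comm_apply]
      exact Submodule.add_mem_sup (ih j hj _ hy)
        (units_smul_mem _ _ (Submodule.mem_map_of_mem (ih j hj _ hw)))

/-! ### Products of operators along words -/

theorem wordProd_cons (a : ι → Module.End ℝ V) (i : ι) (l : List ι) :
    wordProd a (i :: l) = a i * wordProd a l := by simp [wordProd]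

theorem wordProd_append (a : ι → Module.End ℝ V) (l l' : List ι) :
    wordProd a (l ++ l') = wordProd a l * wordProd a l' := by simp [wordProd]

theorem mul_wordProd (ha : IsSignedSystem σ c a) (i : ι) (l : List ι) :
    a i * wordProd a l = commSign c i l • (wordProd a l * a i) := by
  induction l with
  | nil => simp [wordProd, commSign]
  | cons j l ih =>
    rw [wordProd_cons, ← mul_assoc, ha.comm, smul_mul_assoc, mul_assoc, ih, mul_smul_comm,
      smul_smul, mul_assoc]
    simp [commSign]

theorem wordProd_sq (ha : IsSignedSystem σ c a) (l : List ι) :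
    wordProd a l * wordProd a l = sqSign σ c l • 1 := by
  induction l with
  | nil => simp [wordProd, sqSign]
  | cons i l ih =>
    rw [wordProd_cons, ← mul_assoc, mul_assoc (a i) _ (a i)]
    have : wordProd a l * a i = commSign c i l • (a i * wordProd a l) := by
      rw [ha.mul_wordProd, smul_smul_self]
    rw [this, mul_smul_comm, ← mul_assoc, ha.sq, smul_mul_assoc, smul_mul_assoc, smul_mul_assoc,
      one_mul, ih, smul_smul, smul_smul, sqSign, mul_assoc]

theorem wordProd_reverse_mul (ha : IsSignedSystem σ c a) (l : List ι) :
    wordProd a l.reverse * wordProd a l = (l.map σ).prod • 1 := by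
  induction l with
  | nil => simp [wordProd]
  | cons i l ih =>
    rw [List.reverse_cons, wordProd_append, wordProd_cons a i []]
    have : wordProd a [] = 1 := by simp [wordProd]
    rw [this, mul_one, wordProd_cons, mul_assoc, ← mul_assoc (a i), ha.sq, smul_mul_assoc, one_mul, mul_smul_comm, ih,
      smul_smul]
    simp

/-- Up to sign the reversed word and the word itself are both inverse to the word, so comparing the
two signs relates them. -/
theorem wordProd_reverse (ha : IsSignedSystem σ c a) (l : List ι) :
    wordProd a l.reverse = ((l.map σ).prod * sqSign σ c l) • wordProd a l := by
  have h1 : wordProd a l.reverse * (wordProd a l * wordProd a l)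
      = (l.map σ).prod • wordProd a l := by
    rw [← mul_assoc, ha.wordProd_reverse_mul, smul_mul_assoc, one_mul]
  rw [ha.wordProd_sq, mul_smul_comm, mul_one] at h1
  rw [mul_comm, mul_smul, ← h1, smul_smul_self]

theorem conjSum_eq_sum (f : V →ₗ[ℝ] W) (l : List ι) :
    conjSum σ a b l f = (l.sublists'.map fun w =>
      (w.map σ).prod • (wordProd b w ∘ₗ f ∘ₗ wordProd a w.reverse)).sum := by
  induction l with
  | nil => simp [conjSum, wordProd, Module.End.one_eq_id]
  | cons i l ih =>
    rw [conjSum, List.sublists'_cons, List.map_append, List.sum_append, ← ih, List.map_map]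
    congr 1
    rw [ih]
    generalize l.sublists' = L
    induction L with
    | nil => simp
    | cons w L ihL =>
      simp only [List.map_cons, List.sum_cons, LinearMap.add_comp, LinearMap.comp_add, smul_add]
      rw [ihL]
      congr 1
      ext x
      simp [wordProd, smul_smul]

/-- Schur orthogonality: apply the hypothesis to the rank-one maps between basis vectors and add up
the matching matrix entries. Each word then contributes a product of two traces. -/
theorem sum_trace_eq_zero [FiniteDimensional ℝ V] [FiniteDimensional ℝ W] (l : List ι)
    (h : ∀ f : V →ₗ[ℝ] W, conjSum σ a b l f = 0) :
    (l.sublists'.map fun w => (w.map σ).prod • (LinearMap.trace ℝ W (wordProd b w) *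
      LinearMap.trace ℝ V (wordProd a w.reverse))).sum = 0 := by
  let v := Module.finBasis ℝ V
  let w := Module.finBasis ℝ W
  have key : ∀ (f : Module.End ℝ V) (g : Module.End ℝ W),
      LinearMap.trace ℝ W g * LinearMap.trace ℝ V f =
      ∑ i, ∑ j, w.coord j ((g ∘ₗ ((v.coord i).smulRight (w j)) ∘ₗ f) (v i)) := by
    intro f g
    rw [LinearMap.trace_eq_matrix_trace ℝ v, LinearMap.trace_eq_matrix_trace ℝ w, Matrix.trace,
      Matrix.trace, mul_comm, Finset.sum_mul_sum]
    simp [LinearMap.toMatrix_apply]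
  have h0 : ∑ i, ∑ j, w.coord j (conjSum σ a b l ((v.coord i).smulRight (w j)) (v i)) = 0 := by
    simp [h]
  rw [← h0]
  simp_rw [conjSum_eq_sum]
  generalize l.sublists' = L
  induction L with
  | nil => simp
  | cons u L ih =>
    simp only [List.map_cons, List.sum_cons, LinearMap.add_apply, map_add, Finset.sum_add_distrib]
    rw [ih, key]
    simp only [units_smul_linearMap_apply, linearMap_units_smul, Finset.smul_sum]

end IsSignedSystem

/-- After complexification (1 - iJ)/2 is idempotent, so its trace is a rank and therefore real,
while its imaginary part is -tr(J)/2. -/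
theorem trace_eq_zero_of_mul_self_eq_neg_one {V : Type*} [AddCommGroup V] [Module ℝ V]
    [FiniteDimensional ℝ V] (J : Module.End ℝ V) (hJ : J * J = -1) :
    LinearMap.trace ℝ V J = 0 := by
  let v := Module.finBasis ℝ V
  set M := LinearMap.toMatrix v v J
  have hM : M * M = -1 := by
    rw [← LinearMap.toMatrix_mul, hJ]; simp
  set N : Matrix _ _ ℂ := M.map Complex.ofRealHom
  have hN : N * N = -1 := by
    rw [← Matrix.map_mul, hM]
    ext i j
    by_cases h : i = j <;> simp [h]
  set E : Matrix _ _ ℂ := (1 / 2 : ℂ) • (1 - Complex.I • N)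
  have hE : IsIdempotentElem E := by
    have hI : (Complex.I • N) * (Complex.I • N) = 1 := by
      rw [smul_mul_smul_comm, hN, Complex.I_mul_I]; simp
    rw [IsIdempotentElem]
    simp only [E, smul_mul_smul_comm, sub_mul, mul_sub, one_mul, mul_one, hI]
    module
  have hE' : IsIdempotentElem (Matrix.toLin' E) := by
    rw [IsIdempotentElem, Module.End.mul_eq_comp, ← Matrix.toLin'_mul, hE.eq]
  have htr := (LinearMap.IsIdempotentElem.isProj_range _ hE').trace
  rw [Matrix.trace_toLin'_eq] at htr
  have hN' : N.trace = ((M.trace : ℝ) : ℂ) := by simp [N, Matrix.trace]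
  have him := congrArg Complex.im htr
  simp only [E, Matrix.trace_smul, Matrix.trace_sub, hN', Matrix.trace_one] at him
  rw [LinearMap.trace_eq_matrix_trace ℝ v]
  simpa using him

/-! ### Irreducible systems are determined by central signs -/

/-- A family of operators without nontrivial invariant subspaces. -/
def IsIrreducibleFamily {ι V : Type*} [AddCommGroup V] [Module ℝ V] (a : ι → Module.End ℝ V) :
    Prop :=
  Nontrivial V ∧ ∀ N : Submodule ℝ V, (∀ i, ∀ x ∈ N, a i x ∈ N) → N = ⊥ ∨ N = ⊤

namespace IsSignedSystem

variable {ι V W : Type*} [AddCommGroup V] [Module ℝ V] [AddCommGroup W] [Module ℝ W]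
  {σ : ι → ℤˣ} {c : ι → ι → ℤˣ} {a : ι → Module.End ℝ V} {b : ι → Module.End ℝ W}

theorem finiteDimensional_of_irreducible [Finite ι] (ha : IsSignedSystem σ c a)
    (hirr : IsIrreducibleFamily a) : FiniteDimensional ℝ V := by
  have := Fintype.ofFinite ι
  obtain ⟨_, h⟩ := hirr
  obtain ⟨s, hs⟩ := exists_ne (0 : V)
  set l : List ι := Finset.univ.toList
  have hl : ∀ i, i ∈ l := fun i => by simp [l]
  have hfin := finiteDimensional_orbitSpan (a := a) s l
  rcases h (orbitSpan a s l) fun i => ha.orbitSpan_invariant s l i (hl i) with h | h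
  · exact absurd ((Submodule.mem_bot ℝ).mp (h ▸ mem_orbitSpan s l)) hs
  · rw [h] at hfin
    exact Module.Finite.equiv (Submodule.topEquiv (R := ℝ) (M := V))

theorem bijective_of_intertwining (ha : IsIrreducibleFamily a) (hb : IsIrreducibleFamily b)
    (f : V →ₗ[ℝ] W) (hf : ∀ i x, f (a i x) = b i (f x)) (hne : f ≠ 0) :
    Function.Bijective f := by
  constructor
  · rw [← LinearMap.ker_eq_bot]
    refine (ha.2 (LinearMap.ker f) fun i x hx => ?_).resolve_right fun h =>
      hne (LinearMap.ker_eq_top.mp h)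
    rw [LinearMap.mem_ker] at hx ⊢
    rw [hf, hx, map_zero]
  · rw [← LinearMap.range_eq_top]
    refine (hb.2 (LinearMap.range f) ?_).resolve_left fun h =>
      hne (LinearMap.range_eq_bot.mp h)
    rintro i _ ⟨x, rfl⟩
    exact ⟨a i x, hf i x⟩

/-- The fixed space of B is invariant. If it is zero, then B x + x, which is fixed, vanishes for all
x. -/
theorem eq_one_or_eq_neg_one (ha : IsIrreducibleFamily a) (B : Module.End ℝ V)
    (hB : ∀ i, a i * B = B * a i) (hsq : B * B = 1) : B = 1 ∨ B = -1 := by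
  have h1 : ∀ i x, a i (B x) = B (a i x) := fun i x => LinearMap.congr_fun (hB i) x
  have h2 : ∀ x, B (B x) = x := fun x => LinearMap.congr_fun hsq x
  rcases ha.2 (LinearMap.ker (B - 1)) (fun i x hx => by
    have hx' : B x = x := by simpa [sub_eq_zero] using hx
    simp [← h1, hx']) with h | h
  · right
    ext x
    have : B x + x ∈ LinearMap.ker (B - 1) := by simp [h2]; abel
    rw [h, Submodule.mem_bot] at this
    simpa using eq_neg_of_add_eq_zero_left this
  · left
    exact sub_eq_zero.mp (LinearMap.ker_eq_top.mp h)

/-- Sandwiching the word between two copies of `a i` gives -σ i times the word, whereas cyclicity of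
the trace gives the factor σ i. -/
theorem trace_eq_zero_of_commSign (ha : IsSignedSystem σ c a) (i : ι)
    (l : List ι) (h : commSign c i l = -1) : LinearMap.trace ℝ V (wordProd a l) = 0 := by
  have h1 := ha.mul_wordProd i l
  have h2 : a i * wordProd a l * a i = (-σ i) • wordProd a l := by
    rw [h1, h, smul_mul_assoc, mul_assoc, ha.sq, mul_smul_comm, mul_one, smul_smul, neg_one_mul]
  have h3 := congrArg (LinearMap.trace ℝ V) h2
  rw [LinearMap.trace_mul_comm, ← mul_assoc, ha.sq, smul_mul_assoc, one_mul] at h3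
  rcases Int.units_eq_one_or (σ i) with hs | hs <;> rw [hs] at h3 <;>
    simp [Units.smul_def] at h3 <;> linarith

/-- Irreducible systems on which the central involutive words have the same signs are
isomorphic. -/
theorem exists_equiv [Finite ι] (ha : IsSignedSystem σ c a) (hb : IsSignedSystem σ c b)
    (ia : IsIrreducibleFamily a) (ib : IsIrreducibleFamily b) (L : List ι) (hL : ∀ i, i ∈ L)
    (h : ∀ l, l.Sublist L → (∀ i, commSign c i l = 1) → sqSign σ c l = 1 →
      (wordProd a l = 1 ↔ wordProd b l = 1)) :
    ∃ f : V ≃ₗ[ℝ] W, ∀ i x, f (a i x) = b i (f x) := by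
  have fV := ha.finiteDimensional_of_irreducible ia
  have fW := hb.finiteDimensional_of_irreducible ib
  have nV := ia.1
  have nW := ib.1
  -- A nonzero average is an intertwiner, hence bijective by Schur's lemma. Otherwise the
  -- orthogonality relation holds and must be contradicted.
  by_cases hne : ∃ f : V →ₗ[ℝ] W, conjSum σ a b L f ≠ 0
  · obtain ⟨f, hf⟩ := hne
    have hcomm := fun i x => (ha.conjSum_comm hb f L i (hL i) x).symm
    exact ⟨LinearEquiv.ofBijective _ (bijective_of_intertwining ia ib _ hcomm hf), hcomm⟩
  push Not at hne
  have hsum := sum_trace_eq_zero L hne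
  exfalso
  refine (ne_of_gt ?_) hsum
  have hpos : 0 < (Module.finrank ℝ V : ℝ) ∧ 0 < (Module.finrank ℝ W : ℝ) :=
    ⟨by exact_mod_cast Module.finrank_pos, by exact_mod_cast Module.finrank_pos⟩
  have hnonneg : ∀ l ∈ L.sublists', 0 ≤ (l.map σ).prod • (LinearMap.trace ℝ W (wordProd b l) *
      LinearMap.trace ℝ V (wordProd a l.reverse)) := by
    intro l hl
    rw [List.mem_sublists'] at hl
    -- Undoing the reversal replaces the weight by the sign of the square of the word, which is 1
    -- for exactly the words whose traces can survive.
    have hrw : (l.map σ).prod • (LinearMap.trace ℝ W (wordProd b l) *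
        LinearMap.trace ℝ V (wordProd a l.reverse)) =
        sqSign σ c l • (LinearMap.trace ℝ W (wordProd b l) *
          LinearMap.trace ℝ V (wordProd a l)) := by
      rw [ha.wordProd_reverse, Units.smul_def ((l.map σ).prod * sqSign σ c l), map_zsmul,
        ← Units.smul_def, mul_smul_comm, smul_smul, ← mul_assoc, Int.units_mul_self, one_mul]
    rw [hrw]
    by_cases hc : ∀ i, commSign c i l = 1
    · rcases Int.units_eq_one_or (sqSign σ c l) with hs | hs
      · rw [hs, one_smul]
        have ha1 := eq_one_or_eq_neg_one ia (wordProd a l)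
          (fun i => by rw [ha.mul_wordProd, hc i, one_smul]) (by rw [ha.wordProd_sq, hs, one_smul])
        have hb1 := eq_one_or_eq_neg_one ib (wordProd b l)
          (fun i => by rw [hb.mul_wordProd, hc i, one_smul]) (by rw [hb.wordProd_sq, hs, one_smul])
        have hiff := h l hl hc hs
        by_cases h1 : wordProd a l = 1
        · rw [h1, hiff.mp h1, LinearMap.trace_one, LinearMap.trace_one]
          positivity
        · rw [ha1.resolve_left h1, hb1.resolve_left (fun h2 => h1 (hiff.mpr h2)), map_neg, map_neg,
            LinearMap.trace_one, LinearMap.trace_one, neg_mul_neg]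
          positivity
      · rw [trace_eq_zero_of_mul_self_eq_neg_one (wordProd a l) (by
          rw [ha.wordProd_sq, hs]; simp [Units.smul_def]), mul_zero, smul_zero]
    · push Not at hc
      obtain ⟨i, hi⟩ := hc
      rw [ha.trace_eq_zero_of_commSign i l ((Int.units_eq_one_or _).resolve_left hi), mul_zero,
        smul_zero]
  -- The empty word makes the sum strictly positive.
  refine lt_of_lt_of_le ?_ (List.single_le_sum (by simpa using hnonneg) _
    (List.mem_map_of_mem (List.mem_sublists'.mpr (List.nil_sublist L))))
  simpa [wordProd] using mul_pos hpos.2 hpos.1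

end IsSignedSystem

/-! ### Isomorphism, twisting and restriction of signed systems -/

/-- A real vector space with a family of operators satisfying the relations of
`IsSignedSystem`. -/
structure SignedSystem {ι : Type} (σ : ι → ℤˣ) (c : ι → ι → ℤˣ) : Type (u + 1) where
  carrier : Type u
  [addCommGroup : AddCommGroup carrier]
  [module : Module ℝ carrier]
  op : ι → Module.End ℝ carrier
  isSignedSystem : IsSignedSystem σ c op

namespace SignedSystem

attribute [instance] addCommGroup module

variable {ι : Type} {σ : ι → ℤˣ} {c : ι → ι → ℤˣ}

/-- Isomorphism of signed systems. -/
def Isomorphic (X Y : SignedSystem.{u} σ c) : Prop :=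
  ∃ f : X.carrier ≃ₗ[ℝ] Y.carrier, ∀ i x, f (X.op i x) = Y.op i (f x)

theorem Isomorphic.equivalence (σ : ι → ℤˣ) (c : ι → ι → ℤˣ) :
    Equivalence (Isomorphic : SignedSystem.{u} σ c → SignedSystem.{u} σ c → Prop) where
  refl X := ⟨LinearEquiv.refl _ _, fun _ _ => rfl⟩
  symm := by
    rintro X Y ⟨f, hf⟩
    exact ⟨f.symm, fun i x => by rw [LinearEquiv.symm_apply_eq, hf, f.apply_symm_apply]⟩
  trans := by
    rintro X Y Z ⟨f, hf⟩ ⟨g, hg⟩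
    exact ⟨f.trans g, fun i x => by simp [hf, hg]⟩

/-- Isomorphism as an equivalence relation on the irreducible signed systems. -/
def irreducibleSetoid (σ : ι → ℤˣ) (c : ι → ι → ℤˣ) :
    Setoid {X : SignedSystem.{u} σ c // IsIrreducibleFamily X.op} :=
  Setoid.comap Subtype.val ⟨Isomorphic, Isomorphic.equivalence σ c⟩

theorem wordProd_apply_of_intertwining {X Y : SignedSystem.{u} σ c}
    (f : X.carrier ≃ₗ[ℝ] Y.carrier) (hf : ∀ i x, f (X.op i x) = Y.op i (f x)) (l : List ι) :
    ∀ x, f (wordProd X.op l x) = wordProd Y.op l (f x) := by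
  induction l with
  | nil => simp [wordProd]
  | cons i l ih =>
    intro x
    simp only [IsSignedSystem.wordProd_cons, Module.End.mul_apply, hf, ih]

theorem Isomorphic.wordProd_eq_one_iff {X Y : SignedSystem.{u} σ c} (h : X.Isomorphic Y)
    (l : List ι) : wordProd X.op l = 1 ↔ wordProd Y.op l = 1 := by
  have key : ∀ X Y : SignedSystem.{u} σ c, X.Isomorphic Y → wordProd X.op l = 1 →
      wordProd Y.op l = 1 := by
    rintro X Y ⟨f, hf⟩ h1
    ext y
    obtain ⟨x, rfl⟩ := f.surjective y
    rw [← wordProd_apply_of_intertwining f hf, h1]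
    simp
  exact ⟨key X Y h, key Y X ((Isomorphic.equivalence σ c).symm h)⟩

/-- The system in which the operators are multiplied by signs. -/
def twist (X : SignedSystem.{u} σ c) (η : ι → ℤˣ) : SignedSystem.{u} σ c where
  carrier := X.carrier
  op i := η i • X.op i
  isSignedSystem :=
    { sq := fun i => by
        rw [smul_mul_smul_comm, Int.units_mul_self, one_smul, X.isSignedSystem.sq]
      comm := fun i j => by
        rw [smul_mul_smul_comm, smul_mul_smul_comm, X.isSignedSystem.comm, smul_comm,
          mul_comm (η i)] }

theorem wordProd_twist (X : SignedSystem.{u} σ c) (η : ι → ℤˣ) (l : List ι) :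
    wordProd (X.twist η).op l = (l.map η).prod • wordProd X.op l := by
  induction l with
  | nil => simp [wordProd]; rfl
  | cons i l ih =>
    rw [IsSignedSystem.wordProd_cons, ih, IsSignedSystem.wordProd_cons]
    change (η i • X.op i) * _ = _
    rw [List.map_cons, List.prod_cons, ← smul_mul_smul_comm]

theorem twist_irreducible {X : SignedSystem.{u} σ c} (hX : IsIrreducibleFamily X.op)
    (η : ι → ℤˣ) : IsIrreducibleFamily (X.twist η).op := by
  refine ⟨hX.1, fun N hN => hX.2 N fun i x hx => ?_⟩
  have := units_smul_mem N (η i) (hN i x hx)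
  change η i • (η i • X.op i) x ∈ N at this
  rwa [units_smul_linearMap_apply, IsSignedSystem.smul_smul_self] at this

/-- The restriction of a system to an invariant subspace. -/
def restrict (X : SignedSystem.{u} σ c) (N : Submodule ℝ X.carrier)
    (hN : ∀ i, ∀ x ∈ N, X.op i x ∈ N) : SignedSystem.{u} σ c where
  carrier := N
  op i := (X.op i).restrict (hN i)
  isSignedSystem :=
    { sq := fun i => by
        ext x
        simp [X.isSignedSystem.sq_apply, Units.smul_def]
      comm := fun i j => by
        ext x
        simp [X.isSignedSystem.comm_apply i j, Units.smul_def] }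

theorem exists_irreducible [Finite ι] (X : SignedSystem.{u} σ c) [Nontrivial X.carrier] :
    ∃ Y : SignedSystem.{u} σ c, IsIrreducibleFamily Y.op := by
  have := Fintype.ofFinite ι
  -- A nonzero invariant subspace of least finite dimension is irreducible; the orbit span of a
  -- nonzero vector shows that one exists.
  let P : ℕ → Prop := fun d => ∃ N : Submodule ℝ X.carrier, (∀ i, ∀ x ∈ N, X.op i x ∈ N) ∧
    N ≠ ⊥ ∧ FiniteDimensional ℝ N ∧ Module.finrank ℝ N = d
  have hP : ∃ d, P d := by
    obtain ⟨s, hs⟩ := exists_ne (0 : X.carrier)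
    refine ⟨_, orbitSpan X.op s Finset.univ.toList, fun i =>
      X.isSignedSystem.orbitSpan_invariant s _ i (by simp), fun h => hs ?_,
      IsSignedSystem.finiteDimensional_orbitSpan s _, rfl⟩
    have := IsSignedSystem.mem_orbitSpan (a := X.op) s Finset.univ.toList
    rwa [h, Submodule.mem_bot] at this
  classical
  obtain ⟨N, hN, hne, hfin, hd⟩ := Nat.find_spec hP
  refine ⟨X.restrict N hN, Submodule.nontrivial_iff_ne_bot.mpr hne, fun K hK => ?_⟩
  change Submodule ℝ N at K
  by_contra! hcon
  have hlt : Module.finrank ℝ K < Module.finrank ℝ N :=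
    Submodule.finrank_lt hcon.2
  have hKe := LinearEquiv.finrank_eq (Submodule.equivMapOfInjective N.subtype
    N.injective_subtype K)
  refine Nat.find_min hP (m := Module.finrank ℝ K) (by rw [← hd]; exact hlt)
    ⟨K.map N.subtype, ?_, ?_, inferInstance, hKe.symm⟩
  · rintro i _ ⟨x, hx, rfl⟩
    exact ⟨_, hK i x hx, rfl⟩
  · rw [Ne, ← LinearMap.le_ker_iff_map, Submodule.ker_subtype, le_bot_iff]
    exact hcon.1

end SignedSystem

/-! ### Central words of two commuting families -/

/-- The commutation signs of two commuting families of pairwise anticommuting operators. -/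
def twoFamilySign (m n : ℕ) : Fin m ⊕ Fin n → Fin m ⊕ Fin n → ℤˣ
  | .inl i, .inl j => if i = j then 1 else -1
  | .inr i, .inr j => if i = j then 1 else -1
  | _, _ => 1

/-- The indices of the first family. -/
def leftWord (m n : ℕ) : List (Fin m ⊕ Fin n) := (List.finRange m).map Sum.inl

/-- The indices of the second family. -/
def rightWord (m n : ℕ) : List (Fin m ⊕ Fin n) := (List.finRange n).map Sum.inr

theorem prod_map_ite_eq {m : ℕ} (i : Fin m) (l : List (Fin m)) (hl : l.Nodup) :
    (l.map fun j => if i = j then (1 : ℤˣ) else -1).prod =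
      (-1) ^ l.length * if i ∈ l then -1 else 1 := by
  induction l with
  | nil => simp
  | cons j l ih =>
    rw [List.nodup_cons] at hl
    rw [List.map_cons, List.prod_cons, ih hl.2, List.length_cons, pow_succ]
    by_cases h : i = j
    · subst h; simp [hl.1]
    · simp [h]

/-- An operator commutes with a word of even length iff it does not occur in it, and with a word of
odd length iff it does. A central word therefore contains no letter or all of them. -/
theorem eq_nil_or_eq_finRange {m : ℕ} (l : List (Fin m)) (hl : l.Sublist (List.finRange m))
    (h : ∀ i, (l.map fun j => if i = j then (1 : ℤˣ) else -1).prod = 1) :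
    l = [] ∨ Odd m ∧ l = List.finRange m := by
  have hnd : l.Nodup := hl.nodup (List.nodup_finRange m)
  simp only [prod_map_ite_eq _ l hnd] at h
  rcases Nat.even_or_odd l.length with he | ho
  · left
    rw [List.eq_nil_iff_forall_not_mem]
    intro i hi
    have := h i
    rw [he.neg_one_pow, if_pos hi] at this
    exact absurd this (by decide)
  · right
    have hmem : ∀ i, i ∈ l := fun i => by
      by_contra hi
      have := h i
      rw [ho.neg_one_pow, if_neg hi] at this
      exact absurd this (by decide)
    have hlen : (List.finRange m).length ≤ l.length :=
      ((List.nodup_finRange m).subperm fun i _ => hmem i).length_le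
    have := hl.eq_of_length_le hlen
    rw [this, List.length_finRange] at ho
    exact ⟨ho, this⟩

theorem commSign_append {ι : Type*} (c : ι → ι → ℤˣ) (i : ι) (l l' : List ι) :
    commSign c i (l ++ l') = commSign c i l * commSign c i l' := by
  simp [commSign]

theorem commSign_inl_map_inl {m n : ℕ} (i : Fin m) (l : List (Fin m)) :
    commSign (twoFamilySign m n) (.inl i) (l.map Sum.inl) =
      (l.map fun j => if i = j then (1 : ℤˣ) else -1).prod := by
  simp [commSign, twoFamilySign, Function.comp_def]

theorem commSign_inr_map_inr {m n : ℕ} (i : Fin n) (l : List (Fin n)) :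
    commSign (twoFamilySign m n) (.inr i) (l.map Sum.inr) =
      (l.map fun j => if i = j then (1 : ℤˣ) else -1).prod := by
  simp [commSign, twoFamilySign, Function.comp_def]

theorem commSign_inl_map_inr {m n : ℕ} (i : Fin m) (l : List (Fin n)) :
    commSign (twoFamilySign m n) (.inl i) (l.map Sum.inr) = 1 := by
  simp [commSign, twoFamilySign, Function.comp_def]

theorem commSign_inr_map_inl {m n : ℕ} (i : Fin n) (l : List (Fin m)) :
    commSign (twoFamilySign m n) (.inr i) (l.map Sum.inl) = 1 := by
  simp [commSign, twoFamilySign, Function.comp_def]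

theorem commSign_leftWord {m n : ℕ} (hm : Odd m) (i : Fin m ⊕ Fin n) :
    commSign (twoFamilySign m n) i (leftWord m n) = 1 := by
  rcases i with i | i
  · rw [leftWord, commSign_inl_map_inl, prod_map_ite_eq _ _ (List.nodup_finRange m)]
    simp [hm.neg_one_pow]
  · exact commSign_inr_map_inl i _

theorem commSign_rightWord {m n : ℕ} (hn : Odd n) (i : Fin m ⊕ Fin n) :
    commSign (twoFamilySign m n) i (rightWord m n) = 1 := by
  rcases i with i | i
  · exact commSign_inl_map_inr i _
  · rw [rightWord, commSign_inr_map_inr, prod_map_ite_eq _ _ (List.nodup_finRange n)]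
    simp [hn.neg_one_pow]

theorem central_word_eq {m n : ℕ} (l : List (Fin m ⊕ Fin n))
    (hl : l.Sublist (leftWord m n ++ rightWord m n))
    (hc : ∀ i, commSign (twoFamilySign m n) i l = 1) :
    l = [] ∨ (Odd m ∧ l = leftWord m n) ∨ (Odd n ∧ l = rightWord m n) ∨
      (Odd m ∧ Odd n ∧ l = leftWord m n ++ rightWord m n) := by
  obtain ⟨l₁, l₂, rfl, h₁, h₂⟩ := List.sublist_append_iff.mp hl
  obtain ⟨k₁, hk₁, rfl⟩ := List.sublist_map_iff.mp h₁
  obtain ⟨k₂, hk₂, rfl⟩ := List.sublist_map_iff.mp h₂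
  have e₁ := eq_nil_or_eq_finRange k₁ hk₁ fun i => by
    have := hc (.inl i)
    rwa [commSign_append, commSign_inl_map_inr, mul_one, commSign_inl_map_inl] at this
  have e₂ := eq_nil_or_eq_finRange k₂ hk₂ fun i => by
    have := hc (.inr i)
    rwa [commSign_append, commSign_inr_map_inl, one_mul, commSign_inr_map_inr] at this
  rcases e₁ with rfl | ⟨hm, rfl⟩ <;> rcases e₂ with rfl | ⟨hn, rfl⟩ <;>
    simp [leftWord, rightWord, *]

theorem sqSign_append {ι : Type*} (σ : ι → ℤˣ) (c : ι → ι → ℤˣ) (l l' : List ι)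
    (h : ∀ i ∈ l, commSign c i l' = 1) :
    sqSign σ c (l ++ l') = sqSign σ c l * sqSign σ c l' := by
  induction l with
  | nil => simp [sqSign]
  | cons i l ih =>
    rw [List.cons_append, sqSign, sqSign, ih fun j hj => h j (List.mem_cons_of_mem _ hj),
      commSign_append, h i List.mem_cons_self, mul_one]
    simp only [mul_assoc]

/-- Squaring the word moves each letter past all later ones, which is one sign change for every pair
of letters. -/
theorem sqSign_eq_of_anticomm {ι : Type*} (σ : ι → ℤˣ) (c : ι → ι → ℤˣ) (l : List ι)
    (h : l.Pairwise fun i j => c i j = -1) :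
    sqSign σ c l = (-1) ^ l.length.choose 2 * (l.map σ).prod := by
  induction l with
  | nil => simp [sqSign]
  | cons i l ih =>
    rw [List.pairwise_cons] at h
    have : commSign c i l = (-1) ^ l.length := by
      rw [commSign, List.map_congr_left h.1, List.map_const', List.prod_replicate]
    rw [sqSign, ih h.2, this, List.length_cons, Nat.choose_succ_succ' l.length 1, Nat.choose_one_right,
      pow_add, List.map_cons, List.prod_cons]
    ac_rfl

theorem sqSign_leftWord {m n : ℕ} (σ : Fin m ⊕ Fin n → ℤˣ) :
    sqSign σ (twoFamilySign m n) (leftWord m n) = (-1) ^ m.choose 2 * ∏ i, σ (.inl i) := by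
  rw [sqSign_eq_of_anticomm]
  · simp [leftWord, Function.comp_def, List.prod_ofFn, ← List.ofFn_eq_map]
  · rw [leftWord, List.pairwise_map]
    exact (List.nodup_finRange m).imp fun h => by simp [twoFamilySign, h]

theorem sqSign_rightWord {m n : ℕ} (σ : Fin m ⊕ Fin n → ℤˣ) :
    sqSign σ (twoFamilySign m n) (rightWord m n) = (-1) ^ n.choose 2 * ∏ i, σ (.inr i) := by
  rw [sqSign_eq_of_anticomm]
  · simp [rightWord, Function.comp_def, List.prod_ofFn, ← List.ofFn_eq_map]
  · rw [rightWord, List.pairwise_map]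
    exact (List.nodup_finRange n).imp fun h => by simp [twoFamilySign, h]

/-! ### Counting irreducible systems -/

theorem card_quotient_eq {X K : Type*} (r : Setoid X) (f : X → K)
    (hf : ∀ x y, r x y ↔ f x = f y) (hs : Function.Surjective f) :
    Nat.card (Quotient r) = Nat.card K := by
  refine Nat.card_eq_of_bijective (Quotient.lift f fun x y h => (hf x y).mp h) ⟨?_, ?_⟩
  · rintro ⟨x⟩ ⟨y⟩ h
    exact Quotient.sound ((hf x y).mpr h)
  · intro k
    obtain ⟨x, rfl⟩ := hs k
    exact ⟨Quotient.mk r x, rfl⟩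

namespace SignedSystem

theorem wordProd_eq_one_or {ι : Type} {σ : ι → ℤˣ} {c : ι → ι → ℤˣ} {X : SignedSystem.{u} σ c}
    (hX : IsIrreducibleFamily X.op) (l : List ι) (hc : ∀ i, commSign c i l = 1)
    (hs : sqSign σ c l = 1) : wordProd X.op l = 1 ∨ wordProd X.op l = -1 :=
  IsSignedSystem.eq_one_or_eq_neg_one hX _
    (fun i => by rw [X.isSignedSystem.mul_wordProd, hc, one_smul])
    (by rw [X.isSignedSystem.wordProd_sq, hs, one_smul])

/-- Every sign of a central involutive word is attained after twisting. -/
theorem exists_twist_sign {ι : Type} {σ : ι → ℤˣ} {c : ι → ι → ℤˣ} {X : SignedSystem.{u} σ c}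
    (hX : IsIrreducibleFamily X.op) (l : List ι) (hc : ∀ i, commSign c i l = 1)
    (hs : sqSign σ c l = 1) (P : Prop) :
    ∃ e : ℤˣ, ∀ η : ι → ℤˣ, (l.map η).prod = e → (wordProd (X.twist η).op l = 1 ↔ P) := by
  have hne : (-1 : Module.End ℝ X.carrier) ≠ 1 := by
    have := hX.1
    intro h
    obtain ⟨x, hx⟩ := exists_ne (0 : X.carrier)
    have h1 := LinearMap.congr_fun h x
    have h2 : (2 : ℝ) • x = 0 := by
      rw [two_smul]
      exact neg_eq_iff_add_eq_zero.mp h1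
    exact hx ((smul_eq_zero_iff_right two_ne_zero).mp h2)
  -- The word acts as 1 or -1. The sign `e` by which the twist must change it depends only on
  -- whether it already has the desired value.
  by_cases hP : wordProd X.op l = 1 ↔ P
  · refine ⟨1, fun η hη => ?_⟩
    rw [wordProd_twist, hη, one_smul]
    exact hP
  · refine ⟨-1, fun η hη => ?_⟩
    have hw : wordProd (X.twist η).op l = -wordProd X.op l := by
      rw [wordProd_twist, hη, Units.smul_def]; simp; rfl
    rw [hw]
    change -wordProd X.op l = (1 : Module.End ℝ X.carrier) ↔ P
    rcases wordProd_eq_one_or hX l hc hs with h | h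
    · rw [h] at hP ⊢
      simp only [hne, true_iff] at hP ⊢
      tauto
    · rw [h] at hP ⊢
      simp only [hne, neg_neg] at hP ⊢
      tauto

/-- A sign constant on a family of odd size survives in the product, so the two full words can be
twisted independently. -/
theorem prod_map_leftWord {m n : ℕ} (hm : Odd m) (e₁ e₂ : ℤˣ) :
    ((leftWord m n).map (Sum.elim (fun _ => e₁) fun _ => e₂)).prod = e₁ := by
  obtain ⟨k, rfl⟩ := hm
  simp [leftWord, Function.comp_def, pow_succ, pow_mul, Int.units_sq]

theorem prod_map_rightWord {m n : ℕ} (hn : Odd n) (e₁ e₂ : ℤˣ) :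
    ((rightWord m n).map (Sum.elim (fun _ => e₁) fun _ => e₂)).prod = e₂ := by
  obtain ⟨k, rfl⟩ := hn
  simp [rightWord, Function.comp_def, pow_succ, pow_mul, Int.units_sq]

/-- The number of isomorphism classes of irreducible pairs of commuting Clifford systems. -/
theorem card_irreducible {m n : ℕ} (σ : Fin m ⊕ Fin n → ℤˣ)
    (hex : ∃ X : SignedSystem.{u} σ (twoFamilySign m n), IsIrreducibleFamily X.op)
    (s t : ℤˣ) (hs : sqSign σ (twoFamilySign m n) (leftWord m n) = s)
    (ht : sqSign σ (twoFamilySign m n) (rightWord m n) = t) :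
    Nat.card (Quotient (irreducibleSetoid.{u} σ (twoFamilySign m n))) =
      if (Odd m ∧ s = 1) ∧ (Odd n ∧ t = 1) then 4
      else if (Odd m ∧ s = 1) ∨ (Odd n ∧ t = 1) ∨ (Odd m ∧ s = -1) ∧ (Odd n ∧ t = -1) then 2
      else 1 := by
  obtain ⟨X₀, h₀⟩ := hex
  have hcl := fun hm : Odd m => commSign_leftWord (n := n) hm
  have hcr := fun hn : Odd n => commSign_rightWord (m := m) hn
  have hst : Odd n → sqSign σ (twoFamilySign m n) (leftWord m n ++ rightWord m n) = s * t := by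
    intro hn
    rw [sqSign_append _ _ _ _ (fun i _ => hcr hn i), hs, ht]
  have hclr : Odd m → Odd n →
      ∀ i, commSign (twoFamilySign m n) i (leftWord m n ++ rightWord m n) = 1 := by
    intro hm hn i
    rw [commSign_append, hcl hm, hcr hn, one_mul]
  -- Only those of the three nonempty candidate words that are central involutions need to be
  -- compared.
  have hiso : ∀ X Y : {X : SignedSystem.{u} σ (twoFamilySign m n) // IsIrreducibleFamily X.op},
      (Odd m → s = 1 →
        (wordProd X.1.op (leftWord m n) = 1 ↔ wordProd Y.1.op (leftWord m n) = 1)) →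
      (Odd n → t = 1 →
        (wordProd X.1.op (rightWord m n) = 1 ↔ wordProd Y.1.op (rightWord m n) = 1)) →
      (Odd m → Odd n → s * t = 1 →
        (wordProd X.1.op (leftWord m n ++ rightWord m n) = 1 ↔
          wordProd Y.1.op (leftWord m n ++ rightWord m n) = 1)) →
      irreducibleSetoid σ (twoFamilySign m n) X Y := by
    intro X Y h1 h2 h3
    refine IsSignedSystem.exists_equiv X.1.isSignedSystem Y.1.isSignedSystem X.2 Y.2
      (leftWord m n ++ rightWord m n) ?_ ?_
    · rintro (i | i) <;> simp [leftWord, rightWord]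
    · intro l hl hc hsq
      rcases central_word_eq l hl hc with rfl | ⟨hm, rfl⟩ | ⟨hn, rfl⟩ | ⟨hm, hn, rfl⟩
      · simp [wordProd]
      · exact h1 hm (hs ▸ hsq)
      · exact h2 hn (ht ▸ hsq)
      · exact h3 hm hn ((hst hn).symm.trans hsq)
  have hiff : ∀ X Y : {X : SignedSystem.{u} σ (twoFamilySign m n) // IsIrreducibleFamily X.op},
      irreducibleSetoid σ (twoFamilySign m n) X Y →
      ∀ l, wordProd X.1.op l = 1 ↔ wordProd Y.1.op l = 1 :=
    fun X Y h l => Isomorphic.wordProd_eq_one_iff h l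
  have hneg : (-1 : ℤˣ) ≠ 1 := by decide
  split_ifs with h4 h2
  · obtain ⟨⟨hm, rfl⟩, hn, rfl⟩ := h4
    -- The signs of the two full words form a complete invariant with values in `Prop × Prop`; the
    -- sign of their product is determined by them.
    rw [card_quotient_eq _ (fun X => ((wordProd X.1.op (leftWord m n) = 1 : Prop),
      (wordProd X.1.op (rightWord m n) = 1 : Prop)))]
    · simp
    · intro X Y
      simp only [Prod.mk.injEq, eq_iff_iff]
      refine ⟨fun h => ⟨hiff X Y h _, hiff X Y h _⟩, fun ⟨h1, h2⟩ =>
        hiso X Y (fun _ _ => h1) (fun _ _ => h2) fun _ _ _ => ?_⟩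
      rw [IsSignedSystem.wordProd_append, IsSignedSystem.wordProd_append]
      have hX1 := wordProd_eq_one_or X.2 _ (hcl hm) hs
      have hX2 := wordProd_eq_one_or X.2 _ (hcr hn) ht
      have hY1 := wordProd_eq_one_or Y.2 _ (hcl hm) hs
      have hY2 := wordProd_eq_one_or Y.2 _ (hcr hn) ht
      by_cases k1 : wordProd X.1.op (leftWord m n) = 1 <;>
        by_cases k2 : wordProd X.1.op (rightWord m n) = 1
      · simp [k1, k2, h1.mp k1, h2.mp k2]
      · simp [k1, h1.mp k1, h2]
      · simp [k2, h2.mp k2, h1]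
      · rw [hX1.resolve_left k1, hX2.resolve_left k2, hY1.resolve_left (mt h1.mpr k1),
          hY2.resolve_left (mt h2.mpr k2)]
        simp
    · rintro ⟨P, Q⟩
      obtain ⟨e₁, he₁⟩ := exists_twist_sign h₀ _ (hcl hm) hs P
      obtain ⟨e₂, he₂⟩ := exists_twist_sign h₀ _ (hcr hn) ht Q
      exact ⟨⟨_, twist_irreducible h₀ _⟩, Prod.ext
        (propext (he₁ _ (prod_map_leftWord hm e₁ e₂)))
        (propext (he₂ _ (prod_map_rightWord hn e₁ e₂)))⟩
  -- Two classes arise whenever the sign of a single central word is a complete invariant that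
  -- twisting can change.
  · have key : ∀ l : List (Fin m ⊕ Fin n), (∀ i, commSign (twoFamilySign m n) i l = 1) →
        sqSign σ (twoFamilySign m n) l = 1 →
        (∀ e : ℤˣ, ∃ η : Fin m ⊕ Fin n → ℤˣ, (l.map η).prod = e) →
        (∀ X Y : {X : SignedSystem.{u} σ (twoFamilySign m n) // IsIrreducibleFamily X.op},
          (wordProd X.1.op l = 1 ↔ wordProd Y.1.op l = 1) →
            irreducibleSetoid σ (twoFamilySign m n) X Y) →
        Nat.card (Quotient (irreducibleSetoid.{u} σ (twoFamilySign m n))) = 2 := by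
      intro l hc hsq hη h
      rw [card_quotient_eq _ (fun X => (wordProd X.1.op l = 1 : Prop))]
      · simp
      · intro X Y
        rw [eq_iff_iff]
        exact ⟨fun h => hiff X Y h _, h X Y⟩
      · intro P
        obtain ⟨e, he⟩ := exists_twist_sign h₀ _ hc hsq P
        obtain ⟨η, hη⟩ := hη e
        exact ⟨⟨_, twist_irreducible h₀ _⟩, propext (he _ hη)⟩
    rcases h2 with ⟨hm, rfl⟩ | ⟨hn, rfl⟩ | ⟨⟨hm, rfl⟩, hn, rfl⟩
    · have ht1 : Odd n → t = 1 → False := fun hn h => h4 ⟨⟨hm, rfl⟩, hn, h⟩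
      exact key (leftWord m n) (hcl hm) hs (fun e => ⟨_, prod_map_leftWord hm e 1⟩)
        fun X Y h => hiso X Y (fun _ _ => h) (fun hn h => (ht1 hn h).elim)
          fun _ hn h => (ht1 hn (by simpa using h)).elim
    · have hs1 : Odd m → s = 1 → False := fun hm h => h4 ⟨⟨hm, h⟩, hn, rfl⟩
      exact key (rightWord m n) (hcr hn) ht (fun e => ⟨_, prod_map_rightWord hn 1 e⟩)
        fun X Y h => hiso X Y (fun hm h => (hs1 hm h).elim) (fun _ _ => h)
          fun hm _ h => (hs1 hm (by simpa using h)).elim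
    -- Both full words have square -1 and carry no sign, but their product has square 1.
    · refine key (leftWord m n ++ rightWord m n) (hclr hm hn) (by rw [hst hn]; simp)
        (fun e => ⟨Sum.elim (fun _ => e) fun _ => 1, ?_⟩)
        fun X Y h => hiso X Y (fun _ h => (hneg h).elim) (fun _ h => (hneg h).elim)
          fun _ _ _ => h
      rw [List.map_append, List.prod_append, prod_map_leftWord hm, prod_map_rightWord hn, mul_one]
  · rw [card_quotient_eq (K := Unit) _ (fun _ => ())]
    · simp
    · intro X Y
      refine ⟨fun _ => rfl, fun _ => hiso X Y (fun hm h => (h2 (.inl ⟨hm, h⟩)).elim)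
        (fun hn h => (h2 (.inr (.inl ⟨hn, h⟩))).elim) fun hm hn h => (h2 ?_).elim⟩
      rcases Int.units_eq_one_or s with h1 | h1
      · exact .inl ⟨hm, h1⟩
      · rw [h1, neg_one_mul, neg_eq_iff_eq_neg] at h
        exact .inr (.inr ⟨⟨hm, h1⟩, hn, h⟩)
    · exact fun _ => ⟨⟨X₀, h₀⟩, rfl⟩

end SignedSystem

/-! ### Generators and relations of the Clifford tensor product -/

/-- The generators `uᵢ ⊗ 1` and `1 ⊗ wⱼ` of a tensor product of two diagonal Clifford algebras. -/
noncomputable def tensorGen {m n : ℕ} (v : Fin m → ℝ) (w : Fin n → ℝ) : Fin m ⊕ Fin n →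
    CliffordAlgebra (QuadraticMap.weightedSumSquares ℝ v) ⊗[ℝ]
      CliffordAlgebra (QuadraticMap.weightedSumSquares ℝ w)
  | .inl i => CliffordAlgebra.ι (QuadraticMap.weightedSumSquares ℝ v) (Pi.single i 1) ⊗ₜ 1
  | .inr i => 1 ⊗ₜ CliffordAlgebra.ι (QuadraticMap.weightedSumSquares ℝ w) (Pi.single i 1)

theorem weightedSumSquares_single {m : ℕ} (v : Fin m → ℝ) (i : Fin m) :
    QuadraticMap.weightedSumSquares ℝ v (Pi.single i 1) = v i := by
  rw [QuadraticMap.weightedSumSquares_apply, Finset.sum_eq_single i] <;>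
    simp +contextual

theorem ι_single_mul_self {m : ℕ} (v : Fin m → ℝ) (i : Fin m) :
    CliffordAlgebra.ι (QuadraticMap.weightedSumSquares ℝ v) (Pi.single i 1) *
      CliffordAlgebra.ι _ (Pi.single i 1) = algebraMap ℝ _ (v i) := by
  rw [CliffordAlgebra.ι_sq_scalar, weightedSumSquares_single]

theorem ι_single_mul_ι_single {m : ℕ} (v : Fin m → ℝ) {i j : Fin m} (h : i ≠ j) :
    CliffordAlgebra.ι (QuadraticMap.weightedSumSquares ℝ v) (Pi.single i 1) *
      CliffordAlgebra.ι _ (Pi.single j 1) =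
    -(CliffordAlgebra.ι (QuadraticMap.weightedSumSquares ℝ v) (Pi.single j 1) *
      CliffordAlgebra.ι _ (Pi.single i 1)) := by
  have hp : QuadraticMap.polar (QuadraticMap.weightedSumSquares ℝ v)
      (Pi.single i 1) (Pi.single j 1) = 0 := by
    simp only [QuadraticMap.polar, QuadraticMap.weightedSumSquares_apply,
      ← Finset.sum_sub_distrib]
    refine Finset.sum_eq_zero fun k _ => ?_
    by_cases hi : k = i
    · subst hi; simp [h]
    · simp [hi]
  rw [eq_neg_iff_add_eq_zero, CliffordAlgebra.ι_mul_ι_add_swap, hp, map_zero]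

theorem tensorGen_sq {m n : ℕ} (v : Fin m → ℝ) (w : Fin n → ℝ) (i : Fin m ⊕ Fin n) :
    tensorGen v w i * tensorGen v w i = algebraMap ℝ _ (Sum.elim v w i) := by
  rcases i with i | i
  · rw [tensorGen, Algebra.TensorProduct.tmul_mul_tmul, ι_single_mul_self, one_mul]
    rfl
  · rw [tensorGen, Algebra.TensorProduct.tmul_mul_tmul, ι_single_mul_self, one_mul,
      Algebra.TensorProduct.algebraMap_apply']
    rfl

theorem tensorGen_comm {m n : ℕ} (v : Fin m → ℝ) (w : Fin n → ℝ) (i j : Fin m ⊕ Fin n) :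
    tensorGen v w i * tensorGen v w j =
      twoFamilySign m n i j • (tensorGen v w j * tensorGen v w i) := by
  rcases i with i | i <;> rcases j with j | j
  · by_cases h : i = j
    · simp [twoFamilySign, h]
    · simp [twoFamilySign, h, tensorGen, ι_single_mul_ι_single v h, TensorProduct.neg_tmul,
        Units.smul_def]
  · simp [twoFamilySign, tensorGen]
  · simp [twoFamilySign, tensorGen]
  · by_cases h : i = j
    · simp [twoFamilySign, h]
    · simp [twoFamilySign, h, tensorGen, ι_single_mul_ι_single w h, TensorProduct.tmul_neg,
        Units.smul_def]

/-- The generators act on a module by a signed system. -/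
theorem isSignedSystem_lsmul {m n : ℕ} (σ : Fin m ⊕ Fin n → ℤˣ) (v : Fin m → ℝ) (w : Fin n → ℝ)
    (hσ : ∀ i, Sum.elim v w i = ((σ i : ℤ) : ℝ)) (V : Type*) [AddCommGroup V] [Module ℝ V]
    [Module (CliffordAlgebra (QuadraticMap.weightedSumSquares ℝ v) ⊗[ℝ]
      CliffordAlgebra (QuadraticMap.weightedSumSquares ℝ w)) V]
    [IsScalarTower ℝ (CliffordAlgebra (QuadraticMap.weightedSumSquares ℝ v) ⊗[ℝ]
      CliffordAlgebra (QuadraticMap.weightedSumSquares ℝ w)) V] :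
    IsSignedSystem σ (twoFamilySign m n)
      fun i => Algebra.lsmul ℝ ℝ V (tensorGen v w i) where
  sq i := by
    rw [← map_mul, tensorGen_sq, AlgHom.commutes, hσ, Units.smul_def, Algebra.algebraMap_eq_smul_one,
      Int.cast_smul_eq_zsmul]
  comm i j := by
    rw [← map_mul, ← map_mul, tensorGen_comm, Units.smul_def, Units.smul_def, map_zsmul]

/-- For any choice of squares σ, the tensor product of the two diagonal Clifford algebras is nonzero
and acts on itself; an irreducible system is found inside this regular representation. -/
theorem exists_irreducible_system {m n : ℕ} (σ : Fin m ⊕ Fin n → ℤˣ) :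
    ∃ X : SignedSystem.{u} σ (twoFamilySign m n), IsIrreducibleFamily X.op := by
  let v : Fin m → ℝ := fun i => ((σ (.inl i) : ℤ) : ℝ)
  let w : Fin n → ℝ := fun i => ((σ (.inr i) : ℤ) : ℝ)
  have hσ : ∀ i, Sum.elim v w i = ((σ i : ℤ) : ℝ) := by rintro (i | i) <;> rfl
  let _ : Invertible (2 : ℝ) := invertibleOfNonzero two_ne_zero
  let A := CliffordAlgebra (QuadraticMap.weightedSumSquares ℝ v) ⊗[ℝ]
      CliffordAlgebra (QuadraticMap.weightedSumSquares ℝ w)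
  have : Nontrivial A := inferInstance
  let X : SignedSystem.{u} σ (twoFamilySign m n) :=
    { carrier := ULift.{u} A
      op := _
      isSignedSystem := isSignedSystem_lsmul σ v w hσ (ULift.{u} A) }
  have : Nontrivial X.carrier := inferInstanceAs (Nontrivial (ULift.{u} A))
  exact X.exists_irreducible

theorem sum_single_smul_ι {m : ℕ} (v : Fin m → ℝ) (x : Fin m → ℝ) :
    CliffordAlgebra.ι (QuadraticMap.weightedSumSquares ℝ v) x =
      ∑ i, x i • CliffordAlgebra.ι (QuadraticMap.weightedSumSquares ℝ v) (Pi.single i 1) := by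
  simp_rw [← map_smul, ← map_sum]
  congr 1
  ext j
  simp [Pi.single_apply]

theorem tensor_induction {m n : ℕ} (v : Fin m → ℝ) (w : Fin n → ℝ)
    {P : CliffordAlgebra (QuadraticMap.weightedSumSquares ℝ v) ⊗[ℝ]
      CliffordAlgebra (QuadraticMap.weightedSumSquares ℝ w) → Prop}
    (hr : ∀ r : ℝ, P (algebraMap ℝ _ r)) (hg : ∀ i, P (tensorGen v w i))
    (ha : ∀ x y, P x → P y → P (x + y)) (hm : ∀ x y, P x → P y → P (x * y)) (x) : P x := by
  have h0 : P 0 := by simpa using hr 0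
  have hs : ∀ (r : ℝ) x, P x → P (r • x) := fun r x hx => by
    rw [Algebra.smul_def]; exact hm _ _ (hr r) hx
  have hsum : ∀ (k : ℕ) (f : Fin k → _), (∀ i, P (f i)) → P (∑ i, f i) := by
    intro k f hf
    exact Finset.sum_induction f P ha h0 fun i _ => hf i
  have h1 : ∀ a, P (a ⊗ₜ 1) := by
    intro a
    induction a using CliffordAlgebra.induction with
    | algebraMap r => exact hr r
    | ι x =>
      rw [sum_single_smul_ι, TensorProduct.sum_tmul]
      exact hsum _ _ fun i => hs _ _ (hg (.inl i))
    | mul a b ha hb =>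
      simpa using hm _ _ ha hb
    | add a b hpa hpb =>
      rw [TensorProduct.add_tmul]
      exact ha _ _ hpa hpb
  have h2 : ∀ a, P (1 ⊗ₜ a) := by
    intro a
    induction a using CliffordAlgebra.induction with
    | algebraMap r =>
      rw [← Algebra.TensorProduct.algebraMap_apply']
      exact hr r
    | ι x =>
      rw [sum_single_smul_ι, TensorProduct.tmul_sum]
      refine hsum _ _ fun i => ?_
      rw [TensorProduct.tmul_smul]
      exact hs _ _ (hg (.inr i))
    | mul a b ha hb =>
      simpa using hm _ _ ha hb
    | add a b hpa hpb =>
      rw [TensorProduct.tmul_add]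
      exact ha _ _ hpa hpb
  induction x using TensorProduct.induction_on with
  | zero => exact h0
  | tmul a b => simpa using hm _ _ (h1 a) (h2 b)
  | add x y hx hy => exact ha _ _ hx hy

/-- Adding the double sum to its transpose cancels the off-diagonal terms and doubles the diagonal
ones. This is the relation required by the universal property of the Clifford algebra. -/
theorem linearCombination_mul_self {m : ℕ} {A : Type*} [Ring A] [Algebra ℝ A] (a : Fin m → A)
    (hsq : ∀ i, a i * a i = -1) (hanti : ∀ i j, i ≠ j → a i * a j = -(a j * a i))
    (x : Fin m → ℝ) :
    (∑ i, x i • a i) * (∑ i, x i • a i) = algebraMap ℝ A (negSumSquares m x) := by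
  have h1 : (∑ i, x i • a i) * (∑ i, x i • a i) = ∑ i, ∑ j, (x i * x j) • (a i * a j) := by
    simp_rw [Finset.sum_mul_sum, smul_mul_smul_comm]
  have h2 : ∑ i, ∑ j, (x i * x j) • (a i * a j) = ∑ i, ∑ j, (x i * x j) • (a j * a i) := by
    rw [Finset.sum_comm]
    simp_rw [mul_comm (x _) (x _)]
  have h3 : ∀ i j, (x i * x j) • (a i * a j) + (x i * x j) • (a j * a i) =
      if i = j then (-2 * (x i * x i)) • (1 : A) else 0 := by
    intro i j
    split_ifs with h
    · subst h; rw [hsq]; module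
    · rw [hanti i j h]; module
  have h4 : (2 : ℝ) • ((∑ i, x i • a i) * (∑ i, x i • a i)) =
      (2 : ℝ) • algebraMap ℝ A (negSumSquares m x) := by
    rw [two_smul, h1]
    nth_rw 2 [h2]
    simp_rw [← Finset.sum_add_distrib, h3]
    rw [QuadraticMap.weightedSumSquares_apply, Algebra.algebraMap_eq_smul_one, smul_smul]
    simp [Finset.mul_sum, Finset.sum_smul]
  exact smul_right_injective A (two_ne_zero (α := ℝ)) h4

/-- The generators of `C_p ⊗ C_q`. -/
noncomputable abbrev clTensorGen (p q : ℕ) : Fin p ⊕ Fin q → ClTensor p q :=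
  tensorGen (fun _ => -1) fun _ => -1

/-- Operators satisfying the relations of the generators extend to a representation of
`C_p ⊗ C_q`. -/
theorem exists_algHom {p q : ℕ} {V : Type*} [AddCommGroup V] [Module ℝ V]
    {a : Fin p ⊕ Fin q → Module.End ℝ V}
    (ha : IsSignedSystem (fun _ => -1) (twoFamilySign p q) a) :
    ∃ φ : ClTensor p q →ₐ[ℝ] Module.End ℝ V, ∀ i, φ (clTensorGen p q i) = a i := by
  have hsq : ∀ i, a i * a i = -1 := fun i => by rw [ha.sq]; simp [Units.smul_def]
  let f : (Fin p → ℝ) →ₗ[ℝ] Module.End ℝ V := Fintype.linearCombination ℝ fun i => a (.inl i)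
  let g : (Fin q → ℝ) →ₗ[ℝ] Module.End ℝ V := Fintype.linearCombination ℝ fun i => a (.inr i)
  have hf : ∀ x, f x * f x = algebraMap ℝ _ (negSumSquares p x) := fun x =>
    linearCombination_mul_self _ (fun i => hsq _) (fun i j h => by
      rw [ha.comm]; simp [twoFamilySign, h, Units.smul_def]) x
  have hg : ∀ x, g x * g x = algebraMap ℝ _ (negSumSquares q x) := fun x =>
    linearCombination_mul_self _ (fun i => hsq _) (fun i j h => by
      rw [ha.comm]; simp [twoFamilySign, h, Units.smul_def]) x
  have hc : ∀ x y, Commute (f x) (g y) := by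
    intro x y
    refine Commute.sum_left _ _ _ fun i _ => Commute.sum_right _ _ _ fun j _ => ?_
    refine Commute.smul_left (Commute.smul_right ?_ _) _
    exact (ha.comm (.inl i) (.inr j)).trans (one_smul _ _)
  let F := CliffordAlgebra.lift (negSumSquares p) ⟨f, hf⟩
  let G := CliffordAlgebra.lift (negSumSquares q) ⟨g, hg⟩
  have hFG : ∀ x y, Commute (F x) (G y) := by
    intro x y
    induction x using CliffordAlgebra.induction with
    | algebraMap r => rw [AlgHom.commutes]; exact Algebra.commutes r _
    | mul a b ha hb => rw [map_mul]; exact ha.mul_left hb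
    | add a b ha hb => rw [map_add]; exact ha.add_left hb
    | ι x =>
      induction y using CliffordAlgebra.induction with
      | algebraMap r => rw [AlgHom.commutes]; exact (Algebra.commutes r _).symm
      | mul a b ha hb => rw [map_mul]; exact ha.mul_right hb
      | add a b ha hb => rw [map_add]; exact ha.add_right hb
      | ι y =>
        simp only [F, G, CliffordAlgebra.lift_ι_apply]
        exact hc x y
  refine ⟨Algebra.TensorProduct.lift F G hFG, ?_⟩
  rintro (i | i)
  · simp [tensorGen, F, f, Fintype.linearCombination_apply_single]
  · simp [tensorGen, G, g, Fintype.linearCombination_apply_single]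

theorem card_quotient_eq_of_map {X Y : Type*} (r : Setoid X) (s : Setoid Y) (F : X → Y)
    (h : ∀ x x', r x x' ↔ s (F x) (F x')) (hs : ∀ y, ∃ x, s (F x) y) :
    Nat.card (Quotient r) = Nat.card (Quotient s) := by
  refine card_quotient_eq r (fun x => Quotient.mk s (F x)) (fun x y => ?_) ?_
  · rw [h, Quotient.eq]
  · rintro ⟨y⟩
    obtain ⟨x, hx⟩ := hs y
    exact ⟨x, Quotient.sound hx⟩

section Generators

variable {p q : ℕ} {V W : Type*} [AddCommGroup V] [Module ℝ V] [Module (ClTensor p q) V]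
  [IsScalarTower ℝ (ClTensor p q) V] [AddCommGroup W] [Module ℝ W] [Module (ClTensor p q) W]
  [IsScalarTower ℝ (ClTensor p q) W]

theorem exists_submodule_of_invariant (N : Submodule ℝ V)
    (hN : ∀ i, ∀ x ∈ N, clTensorGen p q i • x ∈ N) :
    ∃ N' : Submodule (ClTensor p q) V, N'.restrictScalars ℝ = N := by
  refine ⟨{ N with smul_mem' := fun a => ?_ }, rfl⟩
  induction a using tensor_induction with
  | hr r => intro x hx; rw [algebraMap_smul]; exact N.smul_mem r hx
  | hg i => exact fun {x} hx => hN i x hx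
  | ha a b ha hb => intro x hx; rw [add_smul]; exact N.add_mem (ha hx) (hb hx)
  | hm a b ha hb => intro x hx; rw [mul_smul]; exact ha (hb hx)

theorem exists_linearEquiv_of_comm (f : V ≃ₗ[ℝ] W)
    (hf : ∀ i x, f (clTensorGen p q i • x) = clTensorGen p q i • f x) :
    ∃ g : V ≃ₗ[ClTensor p q] W, ∀ x, g x = f x := by
  refine ⟨{ f with map_smul' := fun a => ?_ }, fun _ => rfl⟩
  simp only [RingHom.id_apply]
  induction a using tensor_induction with
  | hr r => intro x; rw [algebraMap_smul, algebraMap_smul]; exact f.map_smul r x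
  | hg i => exact fun x => hf i x
  | ha a b ha hb =>
    intro x; rw [add_smul, add_smul, ← ha, ← hb]; exact f.map_add _ _
  | hm a b ha hb => intro x; rw [mul_smul, mul_smul, ← hb, ← ha]

theorem comm_smul_real (f : V ≃ₗ[ClTensor p q] W) (r : ℝ) (x : V) : f (r • x) = r • f x := by
  rw [← algebraMap_smul (ClTensor p q), map_smul, algebraMap_smul]

end Generators

/-! ### Ungraded modules as signed systems -/

theorem SignedSystem.Isomorphic.irreducible {ι : Type} {σ : ι → ℤˣ} {c : ι → ι → ℤˣ}
    {X Y : SignedSystem.{u} σ c} (h : X.Isomorphic Y) (hX : IsIrreducibleFamily X.op) :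
    IsIrreducibleFamily Y.op := by
  obtain ⟨f, hf⟩ := h
  obtain ⟨_, hN⟩ := hX
  refine ⟨f.symm.toEquiv.nontrivial, fun N h => ?_⟩
  rcases hN (N.comap f.toLinearMap) fun i x hx => by
    rw [Submodule.mem_comap] at hx ⊢
    exact (hf i x).symm ▸ h i _ hx with h0 | h0
  · left
    rw [eq_bot_iff]
    intro y hy
    have : f.symm y ∈ N.comap f.toLinearMap := by simpa using hy
    rw [h0, Submodule.mem_bot] at this
    simpa using this
  · right
    rw [eq_top_iff]
    intro y _
    have : f.symm y ∈ N.comap f.toLinearMap := h0 ▸ Submodule.mem_top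
    simpa using this

/-- The signed system of the generators acting on a `C_p ⊗ C_q`-module. -/
noncomputable def moduleSystem {p q : ℕ} (M : ModuleCat.{u} (ClTensor p q)) :
    SignedSystem.{u} (fun _ => -1) (twoFamilySign p q) :=
  letI : Module ℝ M := Module.compHom M (algebraMap ℝ (ClTensor p q))
  haveI : IsScalarTower ℝ (ClTensor p q) M := ⟨fun r a x => by
    rw [Algebra.smul_def, mul_smul]; rfl⟩
  { carrier := M
    op := fun i => Algebra.lsmul ℝ ℝ M (clTensorGen p q i)
    isSignedSystem := isSignedSystem_lsmul _ _ _ (by rintro (i | i) <;> simp) M }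

section

variable {p q : ℕ} (M N : ModuleCat.{u} (ClTensor p q))

instance : Module (ClTensor p q) (moduleSystem M).carrier := inferInstanceAs (Module _ M)

instance : IsScalarTower ℝ (ClTensor p q) (moduleSystem M).carrier :=
  ⟨fun r a x => by rw [Algebra.smul_def, mul_smul]; rfl⟩

theorem moduleSystem_isomorphic_iff :
    (moduleSystem M).Isomorphic (moduleSystem N) ↔ CategoryTheory.IsIsomorphic M N := by
  constructor
  · rintro ⟨f, hf⟩
    obtain ⟨g, -⟩ := exists_linearEquiv_of_comm (p := p) (q := q) f hf
    exact ⟨LinearEquiv.toModuleIso (X₁ := M) (X₂ := N) g⟩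
  · rintro ⟨e⟩
    let g : (moduleSystem M).carrier ≃ₗ[ClTensor p q] (moduleSystem N).carrier :=
      e.toLinearEquiv
    exact ⟨{ g with map_smul' := comm_smul_real g }, fun i x => g.map_smul _ x⟩

theorem irreducible_of_indecomposable (h : CategoryTheory.Indecomposable M) :
    IsIrreducibleFamily (moduleSystem M).op := by
  refine ⟨?_, fun K hK => ?_⟩
  · by_contra hM
    rw [not_nontrivial_iff_subsingleton] at hM
    have : Subsingleton M := hM
    exact h.1 (ModuleCat.isZero_of_subsingleton M)
  -- The averaged complement presents `M` as a biproduct, one of whose factors must vanish.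
  · obtain ⟨K', hK', hc⟩ := (moduleSystem M).isSignedSystem.exists_isCompl K hK
    obtain ⟨A, rfl⟩ := exists_submodule_of_invariant (p := p) (q := q) K hK
    obtain ⟨B, rfl⟩ := exists_submodule_of_invariant (p := p) (q := q) K' hK'
    have hAB : IsCompl A B := by
      rw [Submodule.isCompl_restrictScalars_iff] at hc
      exact hc
    let A' : Submodule (ClTensor p q) M := A
    let B' : Submodule (ClTensor p q) M := B
    have e := LinearEquiv.toModuleIso (Submodule.prodEquivOfIsCompl A' B' hAB)
    rcases h.2 (ModuleCat.of _ A') (ModuleCat.of _ B')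
      (e.symm ≪≫ (ModuleCat.biprodIsoProd (ModuleCat.of _ A') (ModuleCat.of _ B')).symm) with h0 | h0
    · left
      have : Subsingleton A := ModuleCat.subsingleton_of_isZero h0
      have hA : A = ⊥ := Submodule.eq_bot_of_subsingleton
      rw [hA, Submodule.restrictScalars_bot]
    · right
      have : Subsingleton B := ModuleCat.subsingleton_of_isZero h0
      have hB : B = ⊥ := Submodule.eq_bot_of_subsingleton
      rw [hB] at hAB
      rw [eq_top_of_isCompl_bot hAB, Submodule.restrictScalars_top]

theorem indecomposable_of_irreducible (h : IsIrreducibleFamily (moduleSystem M).op) :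
    CategoryTheory.Indecomposable M := by
  have : Nontrivial M := h.1
  have : IsSimpleModule (ClTensor p q) M := by
    refine { eq_bot_or_eq_top := fun A => ?_ }
    let A' : Submodule (ClTensor p q) (moduleSystem M).carrier := A
    rcases h.2 (A'.restrictScalars ℝ) (fun i x hx => A'.smul_mem _ hx) with h0 | h0
    · have hA : A' = ⊥ := (Submodule.restrictScalars_eq_bot_iff _ _ _).mp h0
      exact .inl hA
    · have hA : A' = ⊤ := (Submodule.restrictScalars_eq_top_iff _ _ _).mp h0
      exact .inr hA
  have : CategoryTheory.Simple M := (simple_iff_isSimpleModule' M).mpr this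
  exact CategoryTheory.indecomposable_of_simple M

end

theorem exists_moduleSystem_isomorphic {p q : ℕ}
    (X : SignedSystem.{u} (fun _ => -1) (twoFamilySign p q)) :
    ∃ M : ModuleCat.{u} (ClTensor p q), (moduleSystem M).Isomorphic X := by
  obtain ⟨φ, hφ⟩ := exists_algHom X.isSignedSystem
  let _ : Module (ClTensor p q) X.carrier := Module.compHom X.carrier φ.toRingHom
  refine ⟨ModuleCat.of _ X.carrier, ⟨{ AddEquiv.refl X.carrier with map_smul' := ?_ }, ?_⟩⟩
  · intro r (x : X.carrier)
    change φ (algebraMap ℝ _ r) x = r • x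
    rw [AlgHom.commutes]
    rfl
  · intro i x
    change φ (clTensorGen p q i) x = X.op i x
    rw [hφ]

theorem card_ungraded (p q : ℕ) : Nat.card (IndecomposableUngradedClasses.{u} p q) =
    Nat.card (Quotient (SignedSystem.irreducibleSetoid.{u} (fun _ => -1)
      (twoFamilySign p q))) := by
  refine card_quotient_eq_of_map _ _
    (fun M => ⟨moduleSystem M.1, irreducible_of_indecomposable M.1 M.2⟩) ?_ ?_
  · intro M N
    exact (moduleSystem_isomorphic_iff M.1 N.1).symm
  · intro X
    obtain ⟨M, hM⟩ := exists_moduleSystem_isomorphic X.1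
    exact ⟨⟨M, indecomposable_of_irreducible M
      (((SignedSystem.Isomorphic.equivalence _ _).symm hM).irreducible X.2)⟩, hM⟩

/-! ### Bigradings as pairs of commuting involutions -/

/-- The sign `(-1)ᵉ` as a real number. -/
def realParity (e : ZMod 2) : ℝ := if e = 0 then 1 else -1

theorem realParity_zero : realParity 0 = 1 := rfl

theorem realParity_one : realParity 1 = -1 := if_neg (by decide)

theorem zmod_two_cases (e : ZMod 2) : e = 0 ∨ e = 1 := by
  revert e; decide

theorem realParity_mul_self (e : ZMod 2) : realParity e * realParity e = 1 := by
  rcases zmod_two_cases e with rfl | rfl <;> simp [realParity_zero, realParity_one]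

theorem realParity_add (d e : ZMod 2) : realParity (d + e) = realParity d * realParity e := by
  rcases zmod_two_cases d with rfl | rfl <;> rcases zmod_two_cases e with rfl | rfl <;>
    simp [realParity_zero, realParity_one, show (1 + 1 : ZMod 2) = 0 from by decide]

theorem one_add_realParity_mul (d e : ZMod 2) :
    1 + realParity d * realParity e = if d = e then 2 else 0 := by
  rcases zmod_two_cases d with rfl | rfl <;> rcases zmod_two_cases e with rfl | rfl <;>
    norm_num [realParity_zero, realParity_one, show (1 : ZMod 2) ≠ 0 from by decide,
      show (0 : ZMod 2) ≠ 1 from by decide]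

section Eigen

variable {V : Type*} [AddCommGroup V] [Module ℝ V]

/-- The joint eigenspaces of two operators for the eigenvalues `±1`. -/
def jointEigenspace (E₁ E₂ : Module.End ℝ V) (d : ZMod 2 × ZMod 2) : Submodule ℝ V where
  carrier := {x | E₁ x = realParity d.1 • x ∧ E₂ x = realParity d.2 • x}
  zero_mem' := by simp
  add_mem' := by
    rintro x y ⟨h1, h2⟩ ⟨h3, h4⟩
    exact ⟨by rw [map_add, h1, h3, smul_add], by rw [map_add, h2, h4, smul_add]⟩
  smul_mem' := by
    rintro r x ⟨h1, h2⟩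
    exact ⟨by rw [map_smul, h1, smul_comm], by rw [map_smul, h2, smul_comm]⟩

/-- The projection to a joint eigenspace of two commuting involutions. -/
noncomputable def jointProj (E₁ E₂ : Module.End ℝ V) (d : ZMod 2 × ZMod 2) : Module.End ℝ V :=
  (1 / 4 : ℝ) • ((1 + realParity d.1 • E₁) * (1 + realParity d.2 • E₂))

theorem jointProj_apply (E₁ E₂ : Module.End ℝ V) (d : ZMod 2 × ZMod 2) (x : V) :
    jointProj E₁ E₂ d x = (1 / 4 : ℝ) • (x + realParity d.2 • E₂ x +
      realParity d.1 • (E₁ x + realParity d.2 • E₁ (E₂ x))) := by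
  simp [jointProj]

theorem jointProj_of_mem {E₁ E₂ : Module.End ℝ V} (d e : ZMod 2 × ZMod 2) {x : V}
    (hx : x ∈ jointEigenspace E₁ E₂ e) : jointProj E₁ E₂ d x = if d = e then x else 0 := by
  obtain ⟨h1, h2⟩ := hx
  have : jointProj E₁ E₂ d x = ((1 / 4) * ((1 + realParity d.1 * realParity e.1) *
      (1 + realParity d.2 * realParity e.2))) • x := by
    rw [jointProj_apply, h2, map_smul, h1]
    module
  rw [this, one_add_realParity_mul, one_add_realParity_mul]
  by_cases h : d.1 = e.1 <;> by_cases h' : d.2 = e.2 <;> norm_num [Prod.ext_iff, h, h']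

theorem jointProj_mem {E₁ E₂ : Module.End ℝ V} (h1 : ∀ x, E₁ (E₁ x) = x)
    (h2 : ∀ x, E₂ (E₂ x) = x) (h12 : ∀ x, E₂ (E₁ x) = E₁ (E₂ x)) (d : ZMod 2 × ZMod 2) (x : V) :
    jointProj E₁ E₂ d x ∈ jointEigenspace E₁ E₂ d := by
  have p1 := realParity_mul_self d.1
  have p2 := realParity_mul_self d.2
  generalize hs : realParity d.1 = s at p1
  generalize ht : realParity d.2 = t at p2
  constructor
  · rw [jointProj_apply, hs, ht]
    simp only [map_smul, map_add, h1]
    rcases mul_self_eq_one_iff.mp p1 with rfl | rfl <;> module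
  · rw [jointProj_apply, hs, ht]
    simp only [map_smul, map_add, h2, h12]
    rcases mul_self_eq_one_iff.mp p2 with rfl | rfl <;> module

theorem sum_jointProj (E₁ E₂ : Module.End ℝ V) (x : V) : ∑ d, jointProj E₁ E₂ d x = x := by
  rw [Fintype.sum_prod_type]
  change ∑ i : Fin 2, ∑ j : Fin 2, jointProj E₁ E₂ ((i : ZMod 2), (j : ZMod 2)) x = x
  simp only [Fin.sum_univ_two, jointProj_apply]
  rw [show realParity ((0 : Fin 2) : ZMod 2) = 1 from rfl,
    show realParity ((1 : Fin 2) : ZMod 2) = -1 from realParity_one]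
  module

/-- The joint projections are polynomials in the two involutions, so they preserve N, and they add
up to the identity. -/
theorem mem_iSup_inf_jointEigenspace {E₁ E₂ : Module.End ℝ V} (h1 : ∀ x, E₁ (E₁ x) = x)
    (h2 : ∀ x, E₂ (E₂ x) = x) (h12 : ∀ x, E₂ (E₁ x) = E₁ (E₂ x)) (N : Submodule ℝ V)
    (hN1 : ∀ x ∈ N, E₁ x ∈ N) (hN2 : ∀ x ∈ N, E₂ x ∈ N) {x : V} (hx : x ∈ N) :
    x ∈ ⨆ d, N ⊓ jointEigenspace E₁ E₂ d := by
  rw [← sum_jointProj E₁ E₂ x]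
  refine Submodule.sum_mem _ fun d _ => Submodule.mem_iSup_of_mem d
    ⟨?_, jointProj_mem h1 h2 h12 d x⟩
  rw [jointProj_apply]
  exact N.smul_mem _ (N.add_mem (N.add_mem hx (N.smul_mem _ (hN2 x hx)))
    (N.smul_mem _ (N.add_mem (hN1 x hx) (N.smul_mem _ (hN1 _ (hN2 x hx))))))

theorem isInternal_jointEigenspace {E₁ E₂ : Module.End ℝ V} (h1 : ∀ x, E₁ (E₁ x) = x)
    (h2 : ∀ x, E₂ (E₂ x) = x) (h12 : ∀ x, E₂ (E₁ x) = E₁ (E₂ x)) :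
    DirectSum.IsInternal (jointEigenspace E₁ E₂) := by
  rw [DirectSum.isInternal_submodule_iff_iSupIndep_and_iSup_eq_top]
  constructor
  · intro d
    rw [Submodule.disjoint_def]
    intro x hx hx'
    have hle : ⨆ e, ⨆ (_ : e ≠ d), jointEigenspace E₁ E₂ e ≤ LinearMap.ker (jointProj E₁ E₂ d) :=
      iSup₂_le fun e he y hy => by
        rw [LinearMap.mem_ker, jointProj_of_mem d e hy, if_neg he.symm]
    have h0 := hle hx'
    rwa [LinearMap.mem_ker, jointProj_of_mem d d hx, if_pos rfl] at h0
  · rw [eq_top_iff]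
    intro x _
    simpa using mem_iSup_inf_jointEigenspace h1 h2 h12 ⊤ (by simp) (by simp)
      (Submodule.mem_top (x := x))

end Eigen

/-- The squares of the two grading operators and the generators of `C_p ⊗ C_q`. -/
def gradedSquare (p q : ℕ) : Fin (p + 1) ⊕ Fin (q + 1) → ℤˣ :=
  Sum.elim (Fin.cases 1 fun _ => -1) (Fin.cases 1 fun _ => -1)

/-- The family consisting of `E₁`, `E₂` and the operators `a`. -/
def extendFamily {p q : ℕ} {A : Type*} (E₁ E₂ : A) (a : Fin p ⊕ Fin q → A) :
    Fin (p + 1) ⊕ Fin (q + 1) → A :=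
  Sum.elim (Fin.cases E₁ fun i => a (.inl i)) (Fin.cases E₂ fun i => a (.inr i))

/-- Each grading operator takes index 0 of its family and joins it as a further anticommuting
member, of square +1. -/
theorem isSignedSystem_extendFamily {p q : ℕ} {V : Type*} [AddCommGroup V] [Module ℝ V]
    {a : Fin p ⊕ Fin q → Module.End ℝ V}
    (ha : IsSignedSystem (fun _ => -1) (twoFamilySign p q) a) {E₁ E₂ : Module.End ℝ V}
    (h1 : E₁ * E₁ = 1) (h2 : E₂ * E₂ = 1) (h12 : E₁ * E₂ = E₂ * E₁)
    (h1l : ∀ i, E₁ * a (.inl i) = -(a (.inl i) * E₁))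
    (h1r : ∀ i, E₁ * a (.inr i) = a (.inr i) * E₁)
    (h2l : ∀ i, E₂ * a (.inl i) = a (.inl i) * E₂)
    (h2r : ∀ i, E₂ * a (.inr i) = -(a (.inr i) * E₂)) :
    IsSignedSystem (gradedSquare p q) (twoFamilySign (p + 1) (q + 1)) (extendFamily E₁ E₂ a) where
  sq i := by
    rcases i with i | i <;> induction i using Fin.cases <;>
      simp [extendFamily, gradedSquare, h1, h2, ha.sq]
  comm i j := by
    rcases i with i | i <;> rcases j with j | j <;> induction i using Fin.cases with
    | zero =>
      induction j using Fin.cases with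
      | zero => simp [extendFamily, twoFamilySign, h12]
      | succ j =>
        simp [extendFamily, twoFamilySign, h1l, h1r, h2l, h2r, Units.smul_def,
          (Fin.succ_ne_zero j).symm]
    | succ i =>
      induction j using Fin.cases with
      | zero => simp [extendFamily, twoFamilySign, h1l, h1r, h2l, h2r, Units.smul_def]
      | succ j =>
        refine (ha.comm _ _).trans ?_
        simp [extendFamily, twoFamilySign, Fin.succ_inj]

/-- The inclusion of the generators among the operators of a graded module. -/
def generatorIndex {p q : ℕ} : Fin p ⊕ Fin q → Fin (p + 1) ⊕ Fin (q + 1) :=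
  Sum.map Fin.succ Fin.succ

theorem isSignedSystem_comp_generatorIndex {p q : ℕ} {V : Type*} [AddCommGroup V] [Module ℝ V]
    {a : Fin (p + 1) ⊕ Fin (q + 1) → Module.End ℝ V}
    (ha : IsSignedSystem (gradedSquare p q) (twoFamilySign (p + 1) (q + 1)) a) :
    IsSignedSystem (fun _ => -1) (twoFamilySign p q) fun i => a (generatorIndex i) where
  sq i := by
    rw [ha.sq]; rcases i with i | i <;> rfl
  comm i j := by
    rw [ha.comm]
    rcases i with i | i <;> rcases j with j | j <;>
      simp [twoFamilySign, generatorIndex, Fin.succ_inj]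

theorem extendFamily_eq {p q : ℕ} {A : Type*} (a : Fin (p + 1) ⊕ Fin (q + 1) → A) :
    extendFamily (a (.inl 0)) (a (.inr 0)) (fun i => a (generatorIndex i)) = a := by
  ext (i | i) <;> induction i using Fin.cases <;> rfl

theorem involute_of_mem_evenOdd {p : ℕ} (d : ZMod 2) {x : Cl p}
    (hx : x ∈ CliffordAlgebra.evenOdd (negSumSquares p) d) :
    CliffordAlgebra.involute x = realParity d • x := by
  rcases zmod_two_cases d with rfl | rfl
  · rw [CliffordAlgebra.involute_eq_of_mem_even hx, realParity_zero, one_smul]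
  · rw [CliffordAlgebra.involute_eq_of_mem_odd hx, realParity_one, neg_one_smul]

/-! ### Bigraded modules as signed systems -/

namespace BigradedModule

variable {p q : ℕ} (S T : BigradedModule.{u} p q)

theorem linearMap_ext {V : Type*} [AddCommGroup V] [Module ℝ V] {f g : S.carrier →ₗ[ℝ] V}
    (h : ∀ d, ∀ x ∈ S.component d, f x = g x) : f = g := by
  ext x
  have hx : x ∈ ⨆ d, S.component d := by
    rw [S.isInternal.submodule_iSup_eq_top]; exact Submodule.mem_top
  induction hx using Submodule.iSup_induction' with
  | mem d x hx => exact h d x hx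
  | zero => simp
  | add x y _ _ hx hy => rw [map_add, map_add, hx, hy]

/-- The operator acting on the component of each bidegree by a scalar. -/
noncomputable def scalarOp (χ : ZMod 2 × ZMod 2 → ℝ) : Module.End ℝ S.carrier :=
  (DirectSum.toModule ℝ _ _ fun d => χ d • (S.component d).subtype) ∘ₗ
    (LinearEquiv.ofBijective (DirectSum.coeLinearMap S.component) S.isInternal).symm.toLinearMap

theorem scalarOp_apply (χ : ZMod 2 × ZMod 2 → ℝ) {d : ZMod 2 × ZMod 2} {x : S.carrier}
    (hx : x ∈ S.component d) : S.scalarOp χ x = χ d • x := by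
  have : (LinearEquiv.ofBijective (DirectSum.coeLinearMap S.component) S.isInternal).symm x =
      DirectSum.lof ℝ _ (fun d => S.component d) d ⟨x, hx⟩ := by
    rw [LinearEquiv.symm_apply_eq]
    exact (DirectSum.coeLinearMap_lof S.component d ⟨x, hx⟩).symm
  rw [scalarOp, LinearMap.comp_apply, LinearEquiv.coe_coe, this, DirectSum.toModule_lof]
  rfl

/-- The first grading operator. -/
noncomputable def gradingLeft : Module.End ℝ S.carrier := S.scalarOp fun d => realParity d.1

/-- The second grading operator. -/
noncomputable def gradingRight : Module.End ℝ S.carrier := S.scalarOp fun d => realParity d.2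

theorem gradingLeft_apply {d : ZMod 2 × ZMod 2} {x : S.carrier} (hx : x ∈ S.component d) :
    S.gradingLeft x = realParity d.1 • x := S.scalarOp_apply _ hx

theorem gradingRight_apply {d : ZMod 2 × ZMod 2} {x : S.carrier} (hx : x ∈ S.component d) :
    S.gradingRight x = realParity d.2 • x := S.scalarOp_apply _ hx

theorem component_eq (d : ZMod 2 × ZMod 2) :
    S.component d = jointEigenspace S.gradingLeft S.gradingRight d := by
  have hle : ∀ d, S.component d ≤ jointEigenspace S.gradingLeft S.gradingRight d :=
    fun d x hx => ⟨S.gradingLeft_apply hx, S.gradingRight_apply hx⟩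
  refine le_antisymm (hle d) fun x hx => ?_
  -- The joint projection maps each component either identically or to zero, and the components
  -- span; a joint eigenvector is its own projection.
  have hall : ∀ y, jointProj S.gradingLeft S.gradingRight d y ∈ S.component d := by
    intro y
    have hy : y ∈ ⨆ d, S.component d := by
      rw [S.isInternal.submodule_iSup_eq_top]; exact Submodule.mem_top
    induction hy using Submodule.iSup_induction' with
    | mem e y hy =>
      rw [jointProj_of_mem d e (hle e hy)]
      split_ifs with h
      · exact h ▸ hy
      · exact Submodule.zero_mem _
    | zero => simp
    | add y z _ _ hy hz => rw [map_add]; exact Submodule.add_mem _ hy hz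
  have := hall x
  rwa [jointProj_of_mem d d hx, if_pos rfl] at this

theorem smul_inl_mem (i : Fin p) {d : ZMod 2 × ZMod 2} {x : S.carrier}
    (hx : x ∈ S.component d) : clTensorGen p q (.inl i) • x ∈ S.component ((1, 0) + d) := by
  have h1 := CliffordAlgebra.ι_mem_evenOdd_one (negSumSquares p) (Pi.single i 1)
  have h0 : (1 : Cl q) ∈ CliffordAlgebra.evenOdd (negSumSquares q) 0 :=
    Submodule.one_le.mp (CliffordAlgebra.one_le_evenOdd_zero _)
  have h := Submodule.apply_mem_map₂ (TensorProduct.mk ℝ (Cl p) (Cl q)) h1 h0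
  exact S.smul_mem (1, 0) d _ h x hx

theorem smul_inr_mem (i : Fin q) {d : ZMod 2 × ZMod 2} {x : S.carrier}
    (hx : x ∈ S.component d) : clTensorGen p q (.inr i) • x ∈ S.component ((0, 1) + d) := by
  have h1 := CliffordAlgebra.ι_mem_evenOdd_one (negSumSquares q) (Pi.single i 1)
  have h0 : (1 : Cl p) ∈ CliffordAlgebra.evenOdd (negSumSquares p) 0 :=
    Submodule.one_le.mp (CliffordAlgebra.one_le_evenOdd_zero _)
  have h := Submodule.apply_mem_map₂ (TensorProduct.mk ℝ (Cl p) (Cl q)) h0 h1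
  exact S.smul_mem (0, 1) d _ h x hx

theorem gradingLeft_mul_self : S.gradingLeft * S.gradingLeft = 1 :=
  S.linearMap_ext fun d x hx => by
    simp [S.gradingLeft_apply hx, smul_smul, realParity_mul_self]

theorem gradingRight_mul_self : S.gradingRight * S.gradingRight = 1 :=
  S.linearMap_ext fun d x hx => by
    simp [S.gradingRight_apply hx, smul_smul, realParity_mul_self]

theorem grading_comm : S.gradingLeft * S.gradingRight = S.gradingRight * S.gradingLeft :=
  S.linearMap_ext fun d x hx => by
    simp [S.gradingRight_apply hx, S.gradingLeft_apply hx, smul_smul, mul_comm]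

/-- The signed system of the generators and the grading operators of a bigraded module. -/
noncomputable def system :
    SignedSystem.{u} (gradedSquare p q) (twoFamilySign (p + 1) (q + 1)) where
  carrier := S.carrier
  op := extendFamily S.gradingLeft S.gradingRight
    fun i => Algebra.lsmul ℝ ℝ S.carrier (clTensorGen p q i)
  isSignedSystem := isSignedSystem_extendFamily
    (isSignedSystem_lsmul _ _ _ (by rintro (i | i) <;> simp) _)
    S.gradingLeft_mul_self S.gradingRight_mul_self S.grading_comm
    (fun i => S.linearMap_ext fun d x hx => by
      simp [S.gradingLeft_apply hx, S.gradingLeft_apply (S.smul_inl_mem i hx), realParity_add,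
        realParity_one])
    (fun i => S.linearMap_ext fun d x hx => by
      simp [S.gradingLeft_apply hx, S.gradingLeft_apply (S.smul_inr_mem i hx)])
    (fun i => S.linearMap_ext fun d x hx => by
      simp [S.gradingRight_apply hx, S.gradingRight_apply (S.smul_inl_mem i hx)])
    (fun i => S.linearMap_ext fun d x hx => by
      simp [S.gradingRight_apply hx, S.gradingRight_apply (S.smul_inr_mem i hx), realParity_add,
        realParity_one])

/-- This makes bigraded submodules the invariant subspaces of the extended system, so that Maschke's
theorem applies to them. -/
theorem isBigradedSubmodule_iff (N : Submodule (ClTensor p q) S.carrier) :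
    S.IsBigradedSubmodule N ↔ ∀ x ∈ N, S.gradingLeft x ∈ N ∧ S.gradingRight x ∈ N := by
  constructor
  · intro h x hx
    have hx' : x ∈ N.restrictScalars ℝ := hx
    rw [h] at hx'
    refine Submodule.iSup_induction _
      (motive := fun x => S.gradingLeft x ∈ N ∧ S.gradingRight x ∈ N) hx' ?_ (by simp) ?_
    · intro d x hx
      rw [S.gradingLeft_apply hx.2, S.gradingRight_apply hx.2]
      exact ⟨(N.restrictScalars ℝ).smul_mem _ hx.1, (N.restrictScalars ℝ).smul_mem _ hx.1⟩
    · intro x y hx hy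
      rw [map_add, map_add]
      exact ⟨N.add_mem hx.1 hy.1, N.add_mem hx.2 hy.2⟩
  · intro h
    refine le_antisymm (fun x hx => ?_) (iSup_le fun d => inf_le_left)
    simp_rw [S.component_eq]
    exact mem_iSup_inf_jointEigenspace (LinearMap.congr_fun S.gradingLeft_mul_self)
      (LinearMap.congr_fun S.gradingRight_mul_self)
      (fun x => (LinearMap.congr_fun S.grading_comm x).symm) _
      (fun x hx => (h x hx).1) (fun x hx => (h x hx).2) hx

theorem system_isomorphic_iff : S.system.Isomorphic T.system ↔ S.Isomorphic T := by
  constructor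
  · rintro ⟨f, hf⟩
    change S.carrier ≃ₗ[ℝ] T.carrier at f
    have hl : ∀ x, f (S.gradingLeft x) = T.gradingLeft (f x) := hf (.inl 0)
    have hr : ∀ x, f (S.gradingRight x) = T.gradingRight (f x) := hf (.inr 0)
    obtain ⟨g, hg⟩ := exists_linearEquiv_of_comm (p := p) (q := q) f (by
      rintro (i | i)
      · exact hf (.inl i.succ)
      · exact hf (.inr i.succ))
    refine ⟨g, fun d x => ?_⟩
    rw [S.component_eq, T.component_eq, hg]
    change _ = _ ∧ _ = _ ↔ _ = _ ∧ _ = _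
    rw [← hl, ← hr, ← map_smul, ← map_smul, f.injective.eq_iff, f.injective.eq_iff]
  · rintro ⟨g, hg⟩
    let f : S.carrier ≃ₗ[ℝ] T.carrier := { g with map_smul' := comm_smul_real g }
    have hfg : ∀ x, f x = g x := fun _ => rfl
    have hl : f.toLinearMap ∘ₗ S.gradingLeft = T.gradingLeft ∘ₗ f.toLinearMap :=
      S.linearMap_ext fun d x hx => by
        simp [S.gradingLeft_apply hx, hfg, comm_smul_real g, T.gradingLeft_apply ((hg d x).mp hx)]
    have hr : f.toLinearMap ∘ₗ S.gradingRight = T.gradingRight ∘ₗ f.toLinearMap :=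
      S.linearMap_ext fun d x hx => by
        simp [S.gradingRight_apply hx, hfg, comm_smul_real g, T.gradingRight_apply ((hg d x).mp hx)]
    refine ⟨f, ?_⟩
    rintro (i | i) <;> induction i using Fin.cases with
    | zero => first | exact LinearMap.congr_fun hl | exact LinearMap.congr_fun hr
    | succ i => exact fun x => g.map_smul _ x

theorem irreducible_of_isIndecomposable (h : S.IsIndecomposable) :
    IsIrreducibleFamily S.system.op := by
  refine ⟨h.1, fun K hK => ?_⟩
  obtain ⟨K', hK', hc⟩ := S.system.isSignedSystem.exists_isCompl K hK
  change Submodule ℝ S.carrier at K K'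
  have key : ∀ K : Submodule ℝ S.carrier, (∀ i, ∀ x ∈ K, S.system.op i x ∈ K) →
      ∃ A : Submodule (ClTensor p q) S.carrier, A.restrictScalars ℝ = K ∧
        S.IsBigradedSubmodule A := by
    intro K hK
    obtain ⟨A, rfl⟩ := exists_submodule_of_invariant (p := p) (q := q) K (by
      rintro (i | i)
      · exact hK (.inl i.succ)
      · exact hK (.inr i.succ))
    exact ⟨A, rfl, (S.isBigradedSubmodule_iff A).mpr fun x hx =>
      ⟨hK (.inl 0) x hx, hK (.inr 0) x hx⟩⟩
  obtain ⟨A, rfl, hA⟩ := key K hK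
  obtain ⟨B, rfl, hB⟩ := key K' hK'
  have hAB : IsCompl A B := (Submodule.isCompl_restrictScalars_iff _).mp hc
  rcases h.2 A B hA hB hAB with h0 | h0
  · left
    exact (Submodule.restrictScalars_eq_bot_iff _ _ _).mpr h0
  · right
    rw [h0] at hAB
    exact (Submodule.restrictScalars_eq_top_iff _ _ _).mpr (eq_top_of_isCompl_bot hAB)

theorem isIndecomposable_of_irreducible (h : IsIrreducibleFamily S.system.op) :
    S.IsIndecomposable := by
  refine ⟨h.1, fun A B hA _ hAB => ?_⟩
  rw [isBigradedSubmodule_iff] at hA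
  rcases h.2 (A.restrictScalars ℝ) (by
    rintro (i | i) <;> induction i using Fin.cases with
    | zero => first | exact fun x hx => (hA x hx).1 | exact fun x hx => (hA x hx).2
    | succ i => exact fun x hx => A.smul_mem _ hx) with h0 | h0
  · exact .inl ((Submodule.restrictScalars_eq_bot_iff _ _ _).mp h0)
  · right
    rw [(Submodule.restrictScalars_eq_top_iff _ _ _).mp h0] at hAB
    exact eq_bot_of_top_isCompl hAB

end BigradedModule

theorem exists_bigraded_system_isomorphic {p q : ℕ}
    (X : SignedSystem.{u} (gradedSquare p q) (twoFamilySign (p + 1) (q + 1))) :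
    ∃ S : BigradedModule.{u} p q, S.system.Isomorphic X := by
  obtain ⟨φ, hφ⟩ := exists_algHom (isSignedSystem_comp_generatorIndex X.isSignedSystem)
  let _ : Module (ClTensor p q) X.carrier := Module.compHom X.carrier φ.toRingHom
  have hsmul : ∀ (a : ClTensor p q) (x : X.carrier), a • x = φ a x := fun _ _ => rfl
  have htower : IsScalarTower ℝ (ClTensor p q) X.carrier := ⟨fun r a x => by
    rw [hsmul, hsmul, map_smul, LinearMap.smul_apply]⟩
  set E₁ := X.op (.inl 0) with hE₁
  set E₂ := X.op (.inr 0) with hE₂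
  have h1 : ∀ x, E₁ (E₁ x) = x := fun x => by
    rw [X.isSignedSystem.sq_apply]; exact one_smul _ x
  have h2 : ∀ x, E₂ (E₂ x) = x := fun x => by
    rw [X.isSignedSystem.sq_apply]; exact one_smul _ x
  have h12 : ∀ x, E₂ (E₁ x) = E₁ (E₂ x) := fun x => by
    rw [X.isSignedSystem.comm_apply]; exact one_smul _ _
  -- Conjugation by a grading operator implements the grade involution of the corresponding tensor
  -- factor. It suffices to check this on generators.
  have hl : ∀ a x, E₁ (φ a x) =
      φ (Algebra.TensorProduct.map CliffordAlgebra.involute (AlgHom.id ℝ _) a) (E₁ x) := by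
    intro a
    induction a using tensor_induction with
    | hr r => intro x; rw [AlgHom.commutes, AlgHom.commutes, AlgHom.commutes]; simp
    | hg i =>
      intro x
      rcases i with i | i
      · rw [hφ, X.isSignedSystem.comm_apply, tensorGen, Algebra.TensorProduct.map_tmul,
          CliffordAlgebra.involute_ι, map_one, TensorProduct.neg_tmul, map_neg]
        have := hφ (.inl i)
        rw [clTensorGen, tensorGen] at this
        rw [this]
        simp [hE₁, generatorIndex, twoFamilySign, Units.smul_def, (Fin.succ_ne_zero i).symm]
      · rw [hφ, X.isSignedSystem.comm_apply, tensorGen, Algebra.TensorProduct.map_tmul, map_one]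
        have := hφ (.inr i)
        rw [clTensorGen, tensorGen] at this
        rw [AlgHom.id_apply, this]
        simp [hE₁, generatorIndex, twoFamilySign]
    | ha a b ha hb => intro x; simp [ha, hb]
    | hm a b ha hb => intro x; simp [ha, hb]
  have hr : ∀ a x, E₂ (φ a x) =
      φ (Algebra.TensorProduct.map (AlgHom.id ℝ _) CliffordAlgebra.involute a) (E₂ x) := by
    intro a
    induction a using tensor_induction with
    | hr r => intro x; rw [AlgHom.commutes, AlgHom.commutes, AlgHom.commutes]; simp
    | hg i =>
      intro x
      rcases i with i | i
      · rw [hφ, X.isSignedSystem.comm_apply, tensorGen, Algebra.TensorProduct.map_tmul, map_one]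
        have := hφ (.inl i)
        rw [clTensorGen, tensorGen] at this
        rw [AlgHom.id_apply, this]
        simp [hE₂, generatorIndex, twoFamilySign]
      · rw [hφ, X.isSignedSystem.comm_apply, tensorGen, Algebra.TensorProduct.map_tmul,
          CliffordAlgebra.involute_ι, map_one, TensorProduct.tmul_neg, map_neg]
        have := hφ (.inr i)
        rw [clTensorGen, tensorGen] at this
        rw [this]
        simp [hE₂, generatorIndex, twoFamilySign, Units.smul_def, (Fin.succ_ne_zero i).symm]
    | ha a b ha hb => intro x; simp [ha, hb]
    | hm a b ha hb => intro x; simp [ha, hb]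
  have hmem : ∀ (d e : ZMod 2 × ZMod 2), ∀ a ∈ ClTensor.bidegree p q d,
      ∀ s ∈ jointEigenspace E₁ E₂ e, a • s ∈ jointEigenspace E₁ E₂ (d + e) := by
    intro d e a ha s hs
    -- The bidegree part is spanned by tensors of homogeneous elements, on which the two grade
    -- involutions act by the parity signs of `d`.
    have hle : ClTensor.bidegree p q d ≤
        (jointEigenspace E₁ E₂ (d + e)).comap ((LinearMap.applyₗ s) ∘ₗ φ.toLinearMap) := by
      refine Submodule.map₂_le.mpr fun x hx y hy => ?_
      change φ (x ⊗ₜ y) s ∈ jointEigenspace E₁ E₂ (d + e)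
      constructor
      · rw [hl, Algebra.TensorProduct.map_tmul, involute_of_mem_evenOdd _ hx, hs.1, map_smul,
          Prod.fst_add, realParity_add, ← TensorProduct.smul_tmul', map_smul, LinearMap.smul_apply,
          smul_smul, mul_comm]
        rfl
      · rw [hr, Algebra.TensorProduct.map_tmul, involute_of_mem_evenOdd _ hy, hs.2, map_smul,
          Prod.snd_add, realParity_add, TensorProduct.tmul_smul, map_smul, LinearMap.smul_apply,
          smul_smul, mul_comm]
        rfl
    exact hle ha
  let S : BigradedModule.{u} p q :=
    { carrier := X.carrier
      component := jointEigenspace E₁ E₂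
      isInternal := isInternal_jointEigenspace h1 h2 h12
      smul_mem := hmem }
  have hS1 : S.gradingLeft = E₁ := S.linearMap_ext fun d x hx =>
    (S.gradingLeft_apply hx).trans hx.1.symm
  have hS2 : S.gradingRight = E₂ := S.linearMap_ext fun d x hx =>
    (S.gradingRight_apply hx).trans hx.2.symm
  have hop : S.system.op = X.op := by
    have hg : (fun i => Algebra.lsmul ℝ ℝ S.carrier (clTensorGen p q i)) =
        fun i => X.op (generatorIndex i) := by
      ext i x
      change φ _ x = _
      rw [hφ]
    have h : extendFamily S.gradingLeft S.gradingRight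
        (fun i => Algebra.lsmul ℝ ℝ S.carrier (clTensorGen p q i)) = X.op := by
      rw [hS1, hS2, hg]
      exact extendFamily_eq X.op
    exact h
  exact ⟨S, LinearEquiv.refl ℝ X.carrier, fun i x => LinearMap.congr_fun (congrFun hop i) x⟩

theorem card_bigraded (p q : ℕ) : Nat.card (IndecomposableBigradedClasses.{u} p q) =
    Nat.card (Quotient (SignedSystem.irreducibleSetoid.{u} (gradedSquare p q)
      (twoFamilySign (p + 1) (q + 1)))) := by
  refine card_quotient_eq_of_map _ _
    (fun S => ⟨S.1.system, S.1.irreducible_of_isIndecomposable S.2⟩) ?_ ?_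
  · intro S T
    exact (BigradedModule.system_isomorphic_iff S.1 T.1).symm
  · intro X
    obtain ⟨S, hS⟩ := exists_bigraded_system_isomorphic X.1
    exact ⟨⟨S, S.isIndecomposable_of_irreducible
      (((SignedSystem.Isomorphic.equivalence _ _).symm hS).irreducible X.2)⟩, hS⟩

/-! ### Signs modulo 4 and the final count -/

theorem neg_one_pow_choose_two_mul (p : ℕ) :
    (-1 : ℤˣ) ^ p.choose 2 * (-1) ^ p = (-1) ^ (p + 1).choose 2 := by
  rw [← pow_add, Nat.choose_succ_succ' p 1, Nat.choose_one_right, add_comm]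

theorem neg_one_pow_choose_two (n : ℕ) :
    (-1 : ℤˣ) ^ n.choose 2 = if n % 4 ≤ 1 then 1 else -1 := by
  induction n using Nat.strong_induction_on with
  | _ n ih =>
    by_cases h : n < 4
    · interval_cases n <;> decide
    · obtain ⟨k, rfl⟩ : ∃ k, n = k + 4 := ⟨n - 4, by omega⟩
      have hc : (k + 4).choose 2 = k.choose 2 + 2 * (2 * k + 3) := by
        simp only [Nat.choose_succ_succ' _ 1, Nat.choose_one_right]
        have : k.choose (1 + 1) = k.choose 2 := rfl
        omega
      rw [hc, pow_add, pow_mul, Int.units_sq, one_pow, mul_one, ih k (by omega),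
        Nat.add_mod_right]

/-- Oddness of p + 1 makes the full word of the extended family central, and (-1)^(p choose 2) is
its square. -/
theorem odd_succ_and_neg_one_pow_choose_two (p : ℕ) :
    (Odd (p + 1) ∧ (-1 : ℤˣ) ^ p.choose 2 = 1 ↔ p % 4 = 0) ∧
      (Odd (p + 1) ∧ (-1 : ℤˣ) ^ p.choose 2 = -1 ↔ p % 4 = 2) := by
  rw [neg_one_pow_choose_two, Nat.odd_iff]
  have h1 : (-1 : ℤˣ) ≠ 1 := by decide
  split_ifs with h <;> simp only [h1, h1.symm, and_true, and_false, false_iff] <;> omega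

theorem odd_and_neg_one_pow_choose_two (p : ℕ) :
    (Odd p ∧ (-1 : ℤˣ) ^ (p + 1).choose 2 = 1 ↔ p % 4 = 3) ∧
      (Odd p ∧ (-1 : ℤˣ) ^ (p + 1).choose 2 = -1 ↔ p % 4 = 1) := by
  rw [neg_one_pow_choose_two, Nat.odd_iff]
  have h1 : (-1 : ℤˣ) ≠ 1 := by decide
  split_ifs with h <;> simp only [h1, h1.symm, and_true, and_false, false_iff] <;> omega

theorem mainTheorem8 (p q : ℕ) :
    Nat.card (IndecomposableBigradedClasses.{u} p q) =
      (if p % 4 = 0 ∧ q % 4 = 0 then 4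
       else if p % 4 = 0 ∨ q % 4 = 0 ∨ (p % 4 = 2 ∧ q % 4 = 2) then 2
       else 1) ∧
    Nat.card (IndecomposableUngradedClasses.{u} p q) =
      (if p % 4 = 3 ∧ q % 4 = 3 then 4
       else if p % 4 = 3 ∨ q % 4 = 3 ∨ (p % 4 = 1 ∧ q % 4 = 1) then 2
       else 1) := by
  -- In the bigraded case the p generators contribute (-1)^p and the grading operator contributes 1
  -- to the product of squares.
  have hgr : ∀ p : ℕ, (-1 : ℤˣ) ^ (p + 1).choose 2 * (-1) ^ p = (-1) ^ p.choose 2 := by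
    intro p
    rw [← neg_one_pow_choose_two_mul, mul_assoc, Int.units_mul_self, mul_one]
  constructor
  · rw [card_bigraded, SignedSystem.card_irreducible _ (exists_irreducible_system _)
      ((-1) ^ p.choose 2) ((-1) ^ q.choose 2)
      (by rw [sqSign_leftWord, Fin.prod_univ_succ]; simpa [gradedSquare] using hgr p)
      (by rw [sqSign_rightWord, Fin.prod_univ_succ]; simpa [gradedSquare] using hgr q)]
    simp only [odd_succ_and_neg_one_pow_choose_two]
  · rw [card_ungraded, SignedSystem.card_irreducible _ (exists_irreducible_system _)
      ((-1) ^ (p + 1).choose 2) ((-1) ^ (q + 1).choose 2)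
      (by rw [sqSign_leftWord]; simpa using neg_one_pow_choose_two_mul p)
      (by rw [sqSign_rightWord]; simpa using neg_one_pow_choose_two_mul q)]
    simp only [odd_and_neg_one_pow_choose_two]
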